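/- Let $d \ge 1$ be an integer and $\mathbb S^d \subset \mathbb R^{d+1}$ the round unit sphere with Riemannian volume measure $\lambda$. Let $\mathtt{sgn}:[-\infty,\infty]\to\{\pm1\}$ be the sign function with $\mathtt{sgn}(0)=1$, and let $p_H$ be a probability mass function on $\{0,1,2,\dots\}$ with $p_H(h)>0$ for all $h$. Let $q=-d$. Sample $\theta=W$ by drawing $h\sim p_H$ and then a $(d+1)\times h$ matrix $W$ with independent standard Gaussian entries. Let $\mathcal P_\theta$ be the partition of $\mathbb S^d$ induced by $x\mapsto \mathtt{sgn}(W^\top x)\in\{\pm1\}^h$ (the trivial partition if $h=0$), write $\mathcal P_\theta[z]$ for its cell containing $z$, and put $$\alpha(\theta)=\pi^{q}\,p_H(h)^{-1}(-1)^h\binom{q}{h},\qquad K(x,z)=\mathbb E_\theta\big[\alpha(\theta)\,\mathbb I\{x\in\mathcal P_\theta[z]\}\big]\in[0,\infty],$$ where $\binom qh=\frac1{h!}\prod_{j=0}^{h-1}(q-j)$. For training data $D^n=((X_i,Y_i))_{i=1}^n$ in $\mathbb S^d\times\{\pm1\}$ define the weighted infinite ensemble and its classifier by $$\widehat u_n(x)=\sum_{i=1}^n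 Y_i\,K(x,X_i)\in[-\infty,\infty],\qquad \widehat f(x\,\|\,D^n)=\mathtt{sgn}(\widehat u_n(x)).$$ (a sum containing both $+\infty$ and $-\infty$, which needs a repeated point with contradictory labels, is read as $-\infty$). Then the following hold. (a) If $x\notin\{X_1,\dots,X_n\}$, then $\widehat u_n(x)$ is the (absolutely convergent) expectation $\mathbb E_\theta\big[\alpha(\theta)\sum_{i=1}^n Y_i\,\mathbb I\{x\in\mathcal P_\theta[X_i]\}\big]$ , that is, a weighted average over $\theta$ of the functions whose signs are the histogram classifiers over $\mathcal P_\theta$. (b) For every training set in which equal points carry equal labels, $\widehat f(X_i\,\|\,D^n)=Y_i$ for all $i\in\{1,\dots,n\}$. (c) $\widehat f$ has the interpolating-consistent property: let $(X,Y)$ be distributed on $\mathbb S^d\times\{\pm1\}$ such that $X$ has a density with respect to $\lambda$, and let $(X_1,Y_1),(X_2,Y_2),\dots$ be i.i.d. copies of $(X,Y)$, independent of $(X,Y)$. Then, almost surely, $\widehat f(X_i\,\|\,D^n)=Y_i$ for all $n$ and all $i\le n$, and, as $n\to\infty$, $$\Pr\{\widehat f(X\,\|\,D^n)\ne Y \mid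 D^n\}\ \longrightarrow\ \inf_{f:\mathbb S^d\to\{\pm1\}\ \text{measurable}}\Pr\{f(X)\ne Y\}\quad\text{in probability.}$$ -/

import Mathlib

open MeasureTheory ProbabilityTheory Filter
open scoped ENNReal Matrix

namespace InterpolatingEnsemble

/-- The sign function on the extended reals with values in the label set `{±1}`, modelled by `ℤˣ`
(with the convention that the sign of `0` is `+1`). -/
noncomputable def sgn (t : EReal) : ℤˣ := if 0 ≤ t then 1 else -1

/-- The cell `p[x]` of the point `x` in a partition of `M`, a partition being given by its
equivalence relation "lies in the same cell". -/
def cell {M : Type*} (p : Setoid M) (x : M) : Set M := {z | p z x}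

/-- The function `∑ᵢ Yᵢ · 𝕀{x ∈ p[Xᵢ]}` whose sign is the histogram classifier over `p`
for the training data `D = ((Xᵢ, Yᵢ))ᵢ`. -/
noncomputable def histogram {M : Type*} {n : ℕ} (D : Fin n → M × ℤˣ) (p : Setoid M) (x : M) : ℝ :=
  ∑ i, ((D i).2 : ℤ) * (cell p (D i).1).indicator (fun _ => (1 : ℝ)) x

/-- A weighted random partition `(Θ, 𝔓, α)` over `M`. -/
structure WeightedRandomPartition (M : Type*) where
  /-- The parameter space. -/
  Θ : Type
  /-- The σ-algebra of the parameter space. -/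
  measurableSpace : MeasurableSpace Θ
  /-- The partition of `M` with parameter `θ`. -/
  part : Θ → Setoid M
  /-- The distribution of the random parameter. -/
  law : @Measure Θ measurableSpace
  /-- The distribution is a probability measure. -/
  isProbabilityMeasure : IsProbabilityMeasure law
  /-- The weights. -/
  α : Θ → ℝ
  /-- The weights are nonnegative. -/
  α_nonneg : ∀ θ, 0 ≤ α θ

attribute [instance] WeightedRandomPartition.measurableSpace
  WeightedRandomPartition.isProbabilityMeasure

/-- The weighted random partition kernel `K(x, z) = 𝔼_θ [α(θ) · 𝕀{x ∈ p_θ[z]}] ∈ [0, ∞]`. -/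
noncomputable def WeightedRandomPartition.kernel {M : Type*} (rp : WeightedRandomPartition M)
    (x z : M) : ℝ≥0∞ :=
  ∫⁻ θ, ENNReal.ofReal (rp.α θ) * (cell (rp.part θ) z).indicator (fun _ => (1 : ℝ≥0∞)) x ∂rp.law

/-- The weighted infinite ensemble `∑ᵢ Yᵢ · K(x, Xᵢ)`, an extended real number. -/
noncomputable def ensemble {M : Type*} (K : M → M → ℝ≥0∞) {n : ℕ} (D : Fin n → M × ℤˣ) (x : M) :
    EReal :=
  ∑ i, ((((D i).2 : ℤ) : ℝ) : EReal) * (K x (D i).1 : EReal)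

/-- The unit sphere `𝕊^d` in `ℝ^(d+1)`. -/
abbrev Sphere (d : ℕ) : Type := Metric.sphere (0 : EuclideanSpace ℝ (Fin (d + 1))) 1

/-- The Riemannian volume measure of the round sphere `𝕊^d`, that is, its surface measure:
`λ(B) = (d + 1) · Leb {t x | 0 < t < 1, x ∈ B}`. -/
noncomputable def sphereVolume (d : ℕ) : Measure (Sphere d) :=
  (volume : Measure (EuclideanSpace ℝ (Fin (d + 1)))).toSphere

/-- The generalized binomial coefficient `binom(q, h) = (1 / h!) ∏_{j < h} (q - j)`. -/
noncomputable def binom (q : ℝ) (h : ℕ) : ℝ := (∏ j ∈ Finset.range h, (q - j)) / (h.factorial : ℝ)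

theorem binom_sign {q : ℝ} (hq : q < 0) (h : ℕ) : 0 ≤ (-1) ^ h * binom q h := by
  have e : (-1) ^ h * binom q h = (∏ j ∈ Finset.range h, ((j : ℝ) - q)) / (h.factorial : ℝ) := by
    have : ((-1 : ℝ)) ^ h = ∏ _j ∈ Finset.range h, (-1 : ℝ) := by simp
    rw [binom, ← mul_div_assoc, this, ← Finset.prod_mul_distrib]
    congr 1
    exact Finset.prod_congr rfl fun j _ => by ring
  rw [e]
  refine div_nonneg (Finset.prod_nonneg fun j _ => ?_) (by positivity)
  have : (0 : ℝ) ≤ j := by positivity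
  linarith

/-- The product σ-algebra on real matrices. -/
instance matrixMeasurableSpace (m n : ℕ) : MeasurableSpace (Matrix (Fin m) (Fin n) ℝ) :=
  inferInstanceAs (MeasurableSpace (Fin m → Fin n → ℝ))

/-- The law of a `(d+1) × h` matrix with independent standard Gaussian entries. -/
noncomputable def gaussianMatrix (d h : ℕ) : Measure (Matrix (Fin (d + 1)) (Fin h) ℝ) :=
  (Measure.pi fun _ : Fin (d + 1) => Measure.pi fun _ : Fin h => gaussianReal 0 1).map Matrix.of

/-- The law on `⨿_h ℝ^((d+1) × h)` of a random matrix obtained by sampling the number `h` of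
columns from `pH` and then `h` columns of independent standard Gaussian entries. -/
noncomputable def hyperplaneLaw (d : ℕ) (pH : PMF ℕ) :
    Measure (Σ h : ℕ, Matrix (Fin (d + 1)) (Fin h) ℝ) :=
  Measure.sum fun h => pH h • (gaussianMatrix d h).map (Sigma.mk h)

theorem measurable_matrix_of {m n : ℕ} :
    Measurable (Matrix.of : (Fin m → Fin n → ℝ) → Matrix (Fin m) (Fin n) ℝ) :=
  measurable_id

theorem measurable_sigma_mk (d h : ℕ) :
    Measurable (Sigma.mk h : _ → Σ h : ℕ, Matrix (Fin (d + 1)) (Fin h) ℝ) :=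
  Measurable.of_le_map (iInf_le _ h)

theorem isProbabilityMeasure_hyperplaneLaw (d : ℕ) (pH : PMF ℕ) :
    IsProbabilityMeasure (hyperplaneLaw d pH) := by
  have hG : ∀ h, IsProbabilityMeasure ((gaussianMatrix d h).map
      (Sigma.mk h : _ → Σ h : ℕ, Matrix (Fin (d + 1)) (Fin h) ℝ)) := fun h => by
    have : IsProbabilityMeasure (gaussianMatrix d h) :=
      Measure.isProbabilityMeasure_map measurable_matrix_of.aemeasurable
    exact Measure.isProbabilityMeasure_map (measurable_sigma_mk d h).aemeasurable
  refine ⟨?_⟩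
  rw [hyperplaneLaw, Measure.sum_apply _ MeasurableSet.univ]
  simp [pH.tsum_coe]

/-- The weighted random hyperplane arrangement partition of `𝕊^d` with exponent `q < 0` and column
number distribution `pH`: the parameter is a `(d+1) × h` matrix `W`, its partition is the one
induced by `x ↦ sgn (Wᵀ x) ∈ {±1}^h` (so it is trivial for `h = 0`), and its weight is
`π^q · pH(h)⁻¹ · (-1)^h · binom(q, h)`. -/
noncomputable def hyperplaneArrangement (d : ℕ) (q : ℝ) (hq : q < 0) (pH : PMF ℕ) :
    WeightedRandomPartition (Sphere d) where
  Θ := Σ h : ℕ, Matrix (Fin (d + 1)) (Fin h) ℝ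
  measurableSpace := inferInstance
  part W := Setoid.ker fun x : Sphere d => fun j : Fin W.1 => sgn ((W.2ᵀ *ᵥ x.1.ofLp) j : ℝ)
  law := hyperplaneLaw d pH
  isProbabilityMeasure := isProbabilityMeasure_hyperplaneLaw d pH
  α W := Real.pi ^ q * (pH W.1).toReal⁻¹ * ((-1) ^ W.1 * binom q W.1)
  α_nonneg W := mul_nonneg (by positivity) (binom_sign hq W.1)

/-- The weighted random hyperplane arrangement partition of `𝕊^d`, `d ≥ 1`, with `q = -d`. -/
noncomputable abbrev hilbertArrangement (d : ℕ) (hd : 0 < d) (pH : PMF ℕ) :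
    WeightedRandomPartition (Sphere d) :=
  hyperplaneArrangement d (-(d : ℝ)) (neg_lt_zero.mpr (Nat.cast_pos.mpr hd)) pH

/-- `X` has a density with respect to the reference measure `vol`, where `μX` is its law. -/
def HasDensity {M : Type*} [MeasurableSpace M] (vol μX : Measure M) : Prop :=
  ∃ f : M → ℝ≥0∞, Measurable f ∧ ∀ B, MeasurableSet B → μX B = ∫⁻ x in B, f x ∂vol

/-- The misclassification probability `Pr {f(X) ≠ Y}`, where `μ` is the joint law of `(X, Y)`. -/
noncomputable def risk {M : Type*} [MeasurableSpace M] (μ : Measure (M × ℤˣ)) (f : M → ℤˣ) : ℝ :=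
  μ.real {z | f z.1 ≠ z.2}

/-- The Bayes risk, the infimum of `Pr {f(X) ≠ Y}` over all measurable `f : M → {±1}`. -/
noncomputable def bayesRisk {M : Type*} [MeasurableSpace M] (μ : Measure (M × ℤˣ)) : ℝ :=
  ⨅ f : {f : M → ℤˣ // Measurable f}, risk μ f.1

/-- The interpolating-consistent property of a classifier `fhat`, which maps training data
`D : Fin n → M × {±1}` to a function `M → {±1}`. For all i.i.d. data `(Xᵢ, Yᵢ) = Z i` whose common
law `μ` is such that `X` has a density, (1) almost surely all training points are classified
correctly for every sample size, and (2) the probability that a new pair drawn from `μ` is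
misclassified, which is a random variable through the training data, converges in probability to
the Bayes risk. -/
def InterpolatingConsistent.{u, v} {M : Type v} [MeasurableSpace M] (vol : Measure M)
    (fhat : ∀ n : ℕ, (Fin n → M × ℤˣ) → M → ℤˣ) : Prop :=
  ∀ (Ω : Type u) [MeasurableSpace Ω] (P : Measure Ω) [IsProbabilityMeasure P]
    (μ : Measure (M × ℤˣ)) [IsProbabilityMeasure μ] (Z : ℕ → Ω → M × ℤˣ),
    (∀ i, Measurable (Z i)) → (∀ i, P.map (Z i) = μ) → iIndepFun Z P →
    HasDensity vol μ.fst →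
    (∀ᵐ ω ∂P, ∀ n : ℕ, ∀ i : Fin n, fhat n (fun j => Z j ω) (Z i ω).1 = (Z i ω).2) ∧
    TendstoInMeasure P (fun n ω => risk μ (fhat n fun j => Z j ω)) atTop (fun _ => bayesRisk μ)

end InterpolatingEnsemble

open InterpolatingEnsemble

universe u

/-! A standard Gaussian hyperplane separates `x` and `z` with probability `angle x z / π`, so `h`
independent ones fail to separate them with probability `(1 - angle x z / π) ^ h`, and the binomial
series with exponent `-d` turns the weighted average over `h` into the Hilbert kernel
`K(x, z) = (angle x z) ^ (-d)`. It is infinite exactly on the diagonal, whence interpolation.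

The superlevel set `{K(x, ·) ≥ t}` is a ball whose volume is of order `1 / t`. At a Lebesgue point
`x` of the law of the data the weights `K(x, Xᵢ)` therefore have tails of order `1 / t`: truncated
at `n log n`, which with high probability changes none of the first `n`, they have second moments of
order `n log n`, while the mean weights of the two labels differ by an order of `log n`. By
Chebyshev's inequality the label of larger density wins with probability tending to `1`. The excess
risk is the integral of the difference of the label densities over the points where the prediction
differs from the Bayes classifier, and dominated convergence applies. -/

namespace InterpolatingEnsemble

open scoped RealInnerProductSpace

section Sign

instance instDiscreteMeasurableSpaceUnits {M : Type*} [Monoid M] [MeasurableSpace M]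
    [DiscreteMeasurableSpace M] : DiscreteMeasurableSpace Mˣ :=
  ⟨fun s => ⟨Units.val '' s, .of_discrete, Set.preimage_image_eq s Units.val_injective⟩⟩

theorem sgn_eq_one_iff (t : EReal) : sgn t = 1 ↔ 0 ≤ t := by
  unfold sgn
  split_ifs with h <;> simp [h]

theorem sgn_eq_sgn_iff (s t : EReal) : sgn s = sgn t ↔ (0 ≤ s ↔ 0 ≤ t) := by
  rw [← sgn_eq_one_iff, ← sgn_eq_one_iff]
  rcases Int.units_eq_one_or (sgn s) with h | h <;>
    rcases Int.units_eq_one_or (sgn t) with h' | h' <;> simp [h, h']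

theorem measurable_sgn : Measurable sgn :=
  Measurable.ite measurableSet_Ici measurable_const measurable_const

theorem measurableSet_sgn_coe_eq {α : Type*} [MeasurableSpace α] {f g : α → ℝ}
    (hf : Measurable f) (hg : Measurable g) :
    MeasurableSet {a | sgn (f a : EReal) = sgn (g a : EReal)} :=
  measurableSet_eq_fun (measurable_sgn.comp hf.coe_real_ereal)
    (measurable_sgn.comp hg.coe_real_ereal)

end Sign

section GaussianSector

open Real Set

/-- The standard Gaussian measure on `ℝ × ℝ`. -/
noncomputable abbrev gaussianPlane : Measure (ℝ × ℝ) := (gaussianReal 0 1).prod (gaussianReal 0 1)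

theorem gaussianPlane_eq_withDensity :
    gaussianPlane = volume.withDensity
      fun p : ℝ × ℝ => gaussianPDF 0 1 p.1 * gaussianPDF 0 1 p.2 := by
  rw [gaussianPlane, gaussianReal_of_var_ne_zero 0 one_ne_zero,
    prod_withDensity (measurable_gaussianPDF 0 1) (measurable_gaussianPDF 0 1)]
  rfl

theorem gaussianPDF_mul_polar (r φ : ℝ) :
    gaussianPDF 0 1 (r * cos φ) * gaussianPDF 0 1 (r * sin φ) =
      gaussianPDF 0 1 r * gaussianPDF 0 1 0 := by
  simp only [gaussianPDF]
  rw [← ENNReal.ofReal_mul (gaussianPDFReal_nonneg _ _ _),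
    ← ENNReal.ofReal_mul (gaussianPDFReal_nonneg _ _ _)]
  simp only [gaussianPDFReal, NNReal.coe_one, sub_zero]
  rw [mul_mul_mul_comm, ← Real.exp_add, mul_mul_mul_comm _ (rexp (-r ^ 2 / _)), ← Real.exp_add]
  congr 3
  linear_combination (-r ^ 2 / 2) * cos_sq_add_sin_sq φ

theorem gaussianPlane_eq_mul_volume {S : Set (ℝ × ℝ)} {A : Set ℝ} (hS : MeasurableSet S)
    (hA : MeasurableSet A)
    (h : ∀ r φ : ℝ, 0 < r → φ ∈ Ioo (-π) π → ((r * cos φ, r * sin φ) ∈ S ↔ φ ∈ A)) :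
    gaussianPlane S = (∫⁻ r in Ioi (0 : ℝ), ENNReal.ofReal r *
      (gaussianPDF 0 1 r * gaussianPDF 0 1 0)) * volume (A ∩ Ioo (-π) π) := by
  have hvol : volume (A ∩ Ioo (-π) π) = ∫⁻ φ in Ioo (-π) π, A.indicator 1 φ := by
    rw [lintegral_indicator_one hA, Measure.restrict_apply hA]
  rw [hvol, ← lintegral_prod_mul (Measurable.aemeasurable (by fun_prop))
    (measurable_one.indicator hA).aemeasurable, Measure.prod_restrict, ← Measure.volume_eq_prod,
    gaussianPlane_eq_withDensity, withDensity_apply _ hS, ← lintegral_indicator hS,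
    ← lintegral_comp_polarCoord_symm, polarCoord_target]
  refine setLIntegral_congr_fun (measurableSet_Ioi.prod measurableSet_Ioo) ?_
  rintro ⟨r, φ⟩ ⟨hr, hφ⟩
  simp only [polarCoord_symm_apply, smul_eq_mul]
  by_cases hmem : φ ∈ A
  · rw [indicator_of_mem ((h r φ hr hφ).2 hmem), indicator_of_mem hmem, gaussianPDF_mul_polar,
      Pi.one_apply, mul_one]
  · rw [indicator_of_notMem fun hc => hmem ((h r φ hr hφ).1 hc), indicator_of_notMem hmem,
      mul_zero, mul_zero]

theorem gaussianPlane_sector {S : Set (ℝ × ℝ)} {A : Set ℝ} (hS : MeasurableSet S)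
    (hA : MeasurableSet A)
    (h : ∀ r φ : ℝ, 0 < r → φ ∈ Ioo (-π) π → ((r * cos φ, r * sin φ) ∈ S ↔ φ ∈ A)) :
    gaussianPlane S = volume (A ∩ Ioo (-π) π) / ENNReal.ofReal (2 * π) := by
  -- The radial factor need not be computed: the case `S = univ` shows that it is `1 / (2 * π)`.
  have huniv := gaussianPlane_eq_mul_volume MeasurableSet.univ MeasurableSet.univ (by simp)
  rw [measure_univ, univ_inter, Real.volume_Ioo, show π - -π = 2 * π by ring] at huniv
  rw [gaussianPlane_eq_mul_volume hS hA h, ENNReal.eq_inv_of_mul_eq_one_left huniv.symm, mul_comm,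
    div_eq_mul_inv]

theorem cos_pos_and_cos_sub_pos_iff {θ φ : ℝ} (hθ0 : 0 ≤ θ) (hθ : θ ≤ π) (hφ : φ ∈ Ioo (-π) π) :
    0 < cos φ ∧ 0 < cos (φ - θ) ↔ φ ∈ Ioo (θ - π / 2) (π / 2) := by
  constructor
  · rintro ⟨hcos, hcos_sub⟩
    have hlt : φ < π / 2 := by
      by_contra! hle
      exact hcos.not_ge (cos_nonpos_of_pi_div_two_le_of_le hle (by linarith [hφ.2, pi_pos]))
    have hgt : -(π / 2) < φ := by
      by_contra! hle
      rw [← cos_neg] at hcos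
      exact hcos.not_ge (cos_nonpos_of_pi_div_two_le_of_le (by linarith)
        (by linarith [hφ.1, pi_pos]))
    refine ⟨?_, hlt⟩
    by_contra! hle
    rw [← cos_neg] at hcos_sub
    exact hcos_sub.not_ge (cos_nonpos_of_pi_div_two_le_of_le (by linarith) (by linarith))
  · rintro ⟨hgt, hlt⟩
    exact ⟨cos_pos_of_mem_Ioo ⟨by linarith, hlt⟩, cos_pos_of_mem_Ioo ⟨by linarith, by linarith⟩⟩

theorem gaussianPlane_pos_pos {θ : ℝ} (hθ0 : 0 ≤ θ) (hθ : θ ≤ π) :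
    gaussianPlane {p | 0 < p.1 ∧ 0 < cos θ * p.1 + sin θ * p.2} =
      ENNReal.ofReal ((1 - θ / π) / 2) := by
  rw [gaussianPlane_sector (A := Ioo (θ - π / 2) (π / 2)) _ measurableSet_Ioo]
  · rw [inter_eq_left.2 (Ioo_subset_Ioo (by linarith [pi_pos]) (by linarith [pi_pos])),
      Real.volume_Ioo, ← ENNReal.ofReal_div_of_pos (by positivity)]
    congr 1
    field_simp
    ring
  · intro r φ hr hφ
    have hrot : cos θ * (r * cos φ) + sin θ * (r * sin φ) = r * cos (φ - θ) := by
      rw [cos_sub]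
      ring
    rw [← cos_pos_and_cos_sub_pos_iff hθ0 hθ hφ]
    simp only [mem_ofPred_eq, hrot, mul_pos_iff_of_pos_left hr]
  · measurability

theorem gaussianPlane_neg_neg {θ : ℝ} (hθ0 : 0 ≤ θ) (hθ : θ ≤ π) :
    gaussianPlane {p | p.1 < 0 ∧ cos θ * p.1 + sin θ * p.2 < 0} =
      ENNReal.ofReal ((1 - θ / π) / 2) := by
  have hneg : MeasurePreserving (fun x : ℝ => -x) (gaussianReal 0 1) (gaussianReal 0 1) :=
    ⟨measurable_neg, by simpa using gaussianReal_map_neg (μ := 0) (v := 1)⟩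
  rw [← gaussianPlane_pos_pos hθ0 hθ, ← (hneg.prod hneg).measure_preimage]
  · congr 1
    ext p
    simp only [preimage_ofPred_eq, mem_ofPred_eq, Prod.map_fst, Prod.map_snd]
    constructor <;> rintro ⟨h1, h2⟩ <;> constructor <;> linarith
  · exact MeasurableSet.nullMeasurableSet (by measurability)

theorem gaussianPlane_ae_ne_zero {a b : ℝ} (hab : a ≠ 0 ∨ b ≠ 0) :
    ∀ᵐ p ∂gaussianPlane, a * p.1 + b * p.2 ≠ 0 := by
  have hac : gaussianPlane ≪ volume := by
    rw [gaussianPlane_eq_withDensity]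
    exact withDensity_absolutelyContinuous _ _
  let L : ℝ × ℝ →ₗ[ℝ] ℝ := a • LinearMap.fst ℝ ℝ ℝ + b • LinearMap.snd ℝ ℝ ℝ
  have hL : LinearMap.ker L ≠ ⊤ := by
    rw [Ne, LinearMap.ker_eq_top]
    intro h0
    have ha := LinearMap.congr_fun h0 (1, 0)
    have hb := LinearMap.congr_fun h0 (0, 1)
    simp [L] at ha hb
    tauto
  refine measure_mono_null (fun p hp => ?_) (hac (Measure.addHaar_submodule volume _ hL))
  simpa [L] using hp

theorem gaussianPlane_sgn_eq {θ : ℝ} (hθ0 : 0 ≤ θ) (hθ : θ ≤ π) :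
    gaussianPlane {p | sgn (p.1 : EReal) = sgn ((cos θ * p.1 + sin θ * p.2 : ℝ) : EReal)} =
      ENNReal.ofReal (1 - θ / π) := by
  have hae : {p : ℝ × ℝ | sgn (p.1 : EReal) = sgn ((cos θ * p.1 + sin θ * p.2 : ℝ) : EReal)}
      =ᵐ[gaussianPlane] ({p | 0 < p.1 ∧ 0 < cos θ * p.1 + sin θ * p.2} ∪
        {p | p.1 < 0 ∧ cos θ * p.1 + sin θ * p.2 < 0} : Set (ℝ × ℝ)) := by
    have hfst : ∀ᵐ p ∂gaussianPlane, (1 : ℝ) * p.1 + 0 * p.2 ≠ 0 :=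
      gaussianPlane_ae_ne_zero (Or.inl one_ne_zero)
    have hrot : ∀ᵐ p ∂gaussianPlane, cos θ * p.1 + sin θ * p.2 ≠ 0 := by
      refine gaussianPlane_ae_ne_zero ?_
      by_contra! hzero
      simpa [hzero.1, hzero.2] using cos_sq_add_sin_sq θ
    filter_upwards [hfst, hrot] with p hp1 hp2
    rw [one_mul, zero_mul, add_zero] at hp1
    apply propext
    change sgn (p.1 : EReal) = sgn ((cos θ * p.1 + sin θ * p.2 : ℝ) : EReal) ↔
      (0 < p.1 ∧ 0 < cos θ * p.1 + sin θ * p.2) ∨ (p.1 < 0 ∧ cos θ * p.1 + sin θ * p.2 < 0)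
    rw [sgn_eq_sgn_iff, EReal.coe_nonneg, EReal.coe_nonneg]
    grind
  have hdisj : Disjoint {p : ℝ × ℝ | 0 < p.1 ∧ 0 < cos θ * p.1 + sin θ * p.2}
      {p | p.1 < 0 ∧ cos θ * p.1 + sin θ * p.2 < 0} :=
    disjoint_left.2 fun _ hpos hneg => hpos.1.not_gt hneg.1
  have hnonneg : 0 ≤ (1 - θ / π) / 2 :=
    div_nonneg (sub_nonneg.2 (div_le_one_of_le₀ hθ pi_pos.le)) two_pos.le
  rw [measure_congr hae, measure_union hdisj (by measurability), gaussianPlane_pos_pos hθ0 hθ,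
    gaussianPlane_neg_neg hθ0 hθ, ← ENNReal.ofReal_add hnonneg hnonneg, add_halves]

end GaussianSector

section GaussianHyperplane

open Real InnerProductGeometry

variable {E : Type*} [NormedAddCommGroup E] [InnerProductSpace ℝ E]

theorem exists_norm_eq_one_inner_eq_zero (hE : 1 < Module.finrank ℝ E) (x : E) :
    ∃ u : E, ‖u‖ = 1 ∧ ⟪x, u⟫ = 0 := by
  have hne : (ℝ ∙ x)ᗮ ≠ ⊥ := by
    rw [Ne, Submodule.orthogonal_eq_bot_iff]
    intro htop
    have hle := finrank_span_le_card (R := ℝ) ({x} : Set E)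
    rw [htop, finrank_top, Set.toFinset_singleton, Finset.card_singleton] at hle
    exact hE.not_ge hle
  obtain ⟨w, hw, hw0⟩ := Submodule.exists_mem_ne_zero_of_ne_bot hne
  refine ⟨‖w‖⁻¹ • w, norm_smul_inv_norm hw0, ?_⟩
  rw [inner_smul_right, Submodule.mem_orthogonal_singleton_iff_inner_right.1 hw, mul_zero]

theorem norm_sub_cos_angle_smul {x z : E} (hx : ‖x‖ = 1) (hz : ‖z‖ = 1) :
    ‖z - cos (angle x z) • x‖ = sin (angle x z) := by
  have hcos : ⟪z, x⟫ = cos (angle x z) := by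
    rw [cos_angle, hx, hz, real_inner_comm, mul_one, div_one]
  have hsq : ‖z - cos (angle x z) • x‖ ^ 2 = sin (angle x z) ^ 2 := by
    rw [norm_sub_sq_real, inner_smul_right, norm_smul, mul_pow, hx, hz, hcos, norm_eq_abs, sq_abs,
      sin_sq]
    ring
  exact (pow_left_inj₀ (norm_nonneg _) (sin_angle_nonneg _ _) two_ne_zero).1 hsq

theorem exists_polar_decomposition (hE : 1 < Module.finrank ℝ E) {x z : E} (hx : ‖x‖ = 1)
    (hz : ‖z‖ = 1) :
    ∃ u : E, ‖u‖ = 1 ∧ ⟪x, u⟫ = 0 ∧ z = cos (angle x z) • x + sin (angle x z) • u := by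
  rw [← norm_sub_cos_angle_smul hx hz]
  set v := z - cos (angle x z) • x with hv
  have hzv : z = cos (angle x z) • x + v := by rw [hv, add_sub_cancel]
  by_cases hv0 : v = 0
  · obtain ⟨u, hu, hxu⟩ := exists_norm_eq_one_inner_eq_zero hE x
    exact ⟨u, hu, hxu, by rw [hv0, norm_zero, zero_smul, ← hv0]; exact hzv⟩
  · have hxv : ⟪x, v⟫ = 0 := by
      rw [hv, inner_sub_right, inner_smul_right, real_inner_self_eq_norm_sq, cos_angle, hx, hz]
      ring
    refine ⟨‖v‖⁻¹ • v, norm_smul_inv_norm hv0, ?_, ?_⟩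
    · rw [inner_smul_right, hxv, mul_zero]
    · rw [smul_smul, mul_inv_cancel₀ (norm_ne_zero_iff.2 hv0), one_smul]
      exact hzv

variable [FiniteDimensional ℝ E] [MeasurableSpace E] [BorelSpace E]

theorem stdGaussian_map_inner (v : E) :
    (stdGaussian E).map (fun g => ⟪v, g⟫) = gaussianReal 0 (‖v‖₊ ^ 2) := by
  have hlaw : HasGaussianLaw (fun g : E => ⟪v, g⟫) (stdGaussian E) :=
    (IsGaussian.hasGaussianLaw_id (μ := stdGaussian E)).map_fun (innerSL ℝ v)
  have hmean : ∫ g, ⟪v, g⟫ ∂(stdGaussian E) = 0 := integral_strongDual_stdGaussian (innerSL ℝ v)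
  have hvar : Var[fun g => ⟪v, g⟫; stdGaussian E] = ‖v‖ ^ 2 := by
    rw [← innerSL_apply_norm (𝕜 := ℝ) v]
    exact variance_dual_stdGaussian (innerSL ℝ v)
  rw [hlaw.map_eq_gaussianReal, hmean, hvar, Real.toNNReal_pow (norm_nonneg v), norm_toNNReal]

theorem stdGaussian_map_inner_pair {x u : E} (hx : ‖x‖ = 1) (hu : ‖u‖ = 1) (hxu : ⟪x, u⟫ = 0) :
    (stdGaussian E).map (fun g => (⟪x, g⟫, ⟪u, g⟫)) = gaussianPlane := by
  have hlaw : HasGaussianLaw (fun g : E => (⟪x, g⟫, ⟪u, g⟫)) (stdGaussian E) :=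
    (IsGaussian.hasGaussianLaw_id (μ := stdGaussian E)).map_fun
      ((innerSL ℝ x).prod (innerSL ℝ u))
  have hcov : cov[fun g => ⟪x, g⟫, fun g => ⟪u, g⟫; stdGaussian E] = 0 := by
    rw [← covarianceBilin_apply_eq_cov IsGaussian.memLp_two_id, covarianceBilin_stdGaussian]
    exact hxu
  have hindep := hlaw.indepFun_of_covariance_eq_zero hcov
  have hmarginal : ∀ v : E, ‖v‖ = 1 →
      (stdGaussian E).map (fun g => ⟪v, g⟫) = gaussianReal 0 1 := fun v hv => by
    rw [stdGaussian_map_inner, show ‖v‖₊ = 1 from NNReal.eq hv, one_pow]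
  rw [(indepFun_iff_map_prod_eq_prod_map_map (by fun_prop) (by fun_prop)).1 hindep,
    hmarginal x hx, hmarginal u hu]

theorem stdGaussian_sgn_inner_eq (hE : 1 < Module.finrank ℝ E) {x z : E} (hx : ‖x‖ = 1)
    (hz : ‖z‖ = 1) :
    stdGaussian E {g | sgn (⟪x, g⟫ : EReal) = sgn (⟪z, g⟫ : EReal)} =
      ENNReal.ofReal (1 - angle x z / π) := by
  obtain ⟨u, hu, hxu, hzu⟩ := exists_polar_decomposition hE hx hz
  have hinner : ∀ g : E, ⟪z, g⟫ = cos (angle x z) * ⟪x, g⟫ + sin (angle x z) * ⟪u, g⟫ := by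
    intro g
    conv_lhs => rw [hzu]
    simp only [inner_add_left, inner_smul_left, conj_trivial]
  rw [← gaussianPlane_sgn_eq (angle_nonneg x z) (angle_le_pi x z),
    ← stdGaussian_map_inner_pair hx hu hxu, Measure.map_apply (by fun_prop)
      (measurableSet_sgn_coe_eq (by fun_prop) (by fun_prop))]
  simp only [hinner, Set.preimage_ofPred_eq]

end GaussianHyperplane

section RandomPartition

variable {M : Type*} (rp : WeightedRandomPartition M)

namespace WeightedRandomPartition

/-- The event that the random partition does not separate `x` from `z`. -/
def sameCell (x z : M) : Set rp.Θ := {θ | x ∈ cell (rp.part θ) z}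

variable {rp}

theorem indicator_cell_eq_indicator_sameCell {β : Type*} [Zero β] (b : β) (x z : M) (θ : rp.Θ) :
    (cell (rp.part θ) z).indicator (fun _ => b) x =
      (rp.sameCell x z).indicator (fun _ => b) θ :=
  rfl

theorem kernel_eq_setLIntegral {x z : M} (hxz : MeasurableSet (rp.sameCell x z)) :
    rp.kernel x z = ∫⁻ θ in rp.sameCell x z, ENNReal.ofReal (rp.α θ) ∂rp.law := by
  rw [kernel, ← lintegral_indicator hxz]
  refine lintegral_congr fun θ => ?_
  rw [indicator_cell_eq_indicator_sameCell]
  by_cases hθ : θ ∈ rp.sameCell x z <;> simp [hθ]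

theorem integrableOn_sameCell (hα : Measurable rp.α) {x z : M}
    (hxz : MeasurableSet (rp.sameCell x z)) (hK : rp.kernel x z ≠ ⊤) :
    IntegrableOn rp.α (rp.sameCell x z) rp.law := by
  rwa [IntegrableOn, ← lintegral_ofReal_ne_top_iff_integrable hα.aestronglyMeasurable
    (Eventually.of_forall rp.α_nonneg), ← kernel_eq_setLIntegral hxz]

theorem setIntegral_sameCell (hα : Measurable rp.α) {x z : M}
    (hxz : MeasurableSet (rp.sameCell x z)) :
    ∫ θ in rp.sameCell x z, rp.α θ ∂rp.law = (rp.kernel x z).toReal := by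
  rw [integral_eq_lintegral_of_nonneg_ae (Eventually.of_forall rp.α_nonneg)
    hα.aestronglyMeasurable, kernel_eq_setLIntegral hxz]

end WeightedRandomPartition

theorem ensemble_eq_coe_sum {K : M → M → ℝ≥0∞} {n : ℕ} {D : Fin n → M × ℤˣ} {x : M}
    (hK : ∀ i, K x (D i).1 ≠ ⊤) :
    ensemble K D x = ((∑ i, (((D i).2 : ℤ) : ℝ) * (K x (D i).1).toReal : ℝ) : EReal) := by
  refine Eq.trans (Finset.sum_congr rfl fun i _ => ?_)
    (map_sum (⟨⟨Real.toEReal, EReal.coe_zero⟩, EReal.coe_add⟩ : ℝ →+ EReal) _ _).symm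
  change _ = (((((D i).2 : ℤ) : ℝ) * (K x (D i).1).toReal : ℝ) : EReal)
  rw [EReal.coe_mul, EReal.coe_ennreal_toReal (hK i)]

theorem ensemble_kernel_eq_integral_histogram (hα : Measurable rp.α)
    (hcell : ∀ x z, MeasurableSet (rp.sameCell x z)) {n : ℕ} {D : Fin n → M × ℤˣ} {x : M}
    (hK : ∀ i, rp.kernel x (D i).1 ≠ ⊤) :
    Integrable (fun θ => rp.α θ * histogram D (rp.part θ) x) rp.law ∧
    ensemble rp.kernel D x =
      ((∫ θ, rp.α θ * histogram D (rp.part θ) x ∂rp.law : ℝ) : EReal) := by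
  have hsum : (fun θ => rp.α θ * histogram D (rp.part θ) x) = fun θ =>
      ∑ i, (((D i).2 : ℤ) : ℝ) * (rp.sameCell x (D i).1).indicator rp.α θ := by
    funext θ
    rw [histogram, Finset.mul_sum]
    refine Finset.sum_congr rfl fun i _ => ?_
    rw [WeightedRandomPartition.indicator_cell_eq_indicator_sameCell, mul_left_comm]
    by_cases hθ : θ ∈ rp.sameCell x (D i).1 <;> simp [hθ]
  have hint : ∀ i, Integrable
      (fun θ => (((D i).2 : ℤ) : ℝ) * (rp.sameCell x (D i).1).indicator rp.α θ) rp.law :=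
    fun i => ((integrable_indicator_iff (hcell _ _)).2
      (WeightedRandomPartition.integrableOn_sameCell hα (hcell _ _) (hK i))).const_mul _
  rw [hsum, ensemble_eq_coe_sum hK, integral_finsetSum _ fun i _ => hint i]
  refine ⟨integrable_finsetSum _ fun i _ => hint i, ?_⟩
  congr 1
  refine Finset.sum_congr rfl fun i _ => ?_
  rw [integral_const_mul, integral_indicator (hcell _ _),
    WeightedRandomPartition.setIntegral_sameCell hα (hcell _ _)]

end RandomPartition

section GaussianMatrix

theorem map_swap_pi_pi {ι κ X : Type*} [Fintype ι] [Fintype κ] [MeasurableSpace X]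
    (ν : ι → κ → Measure X) [∀ i j, IsProbabilityMeasure (ν i j)] :
    (Measure.pi fun i => Measure.pi (ν i)).map (Function.swap : (ι → κ → X) → κ → ι → X) =
      Measure.pi fun j => Measure.pi fun i => ν i j := by
  have hreindex : (Measure.infinitePi fun p : ι × κ => ν p.1 p.2).map
      (fun ω (p : κ × ι) => ω p.swap) = Measure.infinitePi fun p : κ × ι => ν p.2 p.1 :=
    Measure.map_infinitePi_infinitePi_of_inj Prod.swap_injective
  simp only [← Measure.infinitePi_eq_pi]
  rw [← Measure.infinitePi_map_curry, ← Measure.infinitePi_map_curry, ← hreindex,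
    Measure.map_map (by fun_prop) (by fun_prop), Measure.map_map (by fun_prop) (by fun_prop)]
  rfl

theorem gaussianMatrix_forall_col (d h : ℕ) {S : Set (EuclideanSpace ℝ (Fin (d + 1)))}
    (hS : MeasurableSet S) :
    gaussianMatrix d h {W | ∀ j, WithLp.toLp 2 (fun i => W i j) ∈ S} =
      stdGaussian (EuclideanSpace ℝ (Fin (d + 1))) S ^ h := by
  set T : Set (Fin (d + 1) → ℝ) := WithLp.toLp 2 ⁻¹' S
  have htoLp : Measurable (WithLp.toLp 2 : (Fin (d + 1) → ℝ) → EuclideanSpace ℝ (Fin (d + 1))) :=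
    by fun_prop
  have hcols : MeasurableSet (Set.pi Set.univ fun _ : Fin h => T) :=
    MeasurableSet.univ_pi fun _ => htoLp hS
  have hswap : Measurable (Function.swap : (Fin (d + 1) → Fin h → ℝ) → Fin h → Fin (d + 1) → ℝ) :=
    by fun_prop
  calc gaussianMatrix d h {W | ∀ j, WithLp.toLp 2 (fun i => W i j) ∈ S}
    _ = gaussianMatrix d h (Function.swap ⁻¹' Set.pi Set.univ fun _ => T) := by
      congr 1
      ext W
      exact Set.mem_univ_pi.symm
    _ = (Measure.pi fun _ : Fin h => Measure.pi fun _ : Fin (d + 1) => gaussianReal 0 1)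
          (Set.pi Set.univ fun _ => T) := by
      rw [← map_swap_pi_pi, Measure.map_apply hswap hcols]
      exact Measure.map_apply measurable_matrix_of (hswap hcols)
    _ = stdGaussian (EuclideanSpace ℝ (Fin (d + 1))) S ^ h := by
      rw [Measure.pi_pi, Finset.prod_const, Finset.card_univ, Fintype.card_fin,
        ← map_pi_eq_stdGaussian, Measure.map_apply htoLp hS]

theorem measurable_comp_sigma_fst {ι β : Type*} {X : ι → Type*} [∀ i, MeasurableSpace (X i)]
    [MeasurableSpace β] (w : ι → β) : Measurable fun W : Σ i, X i => w W.1 := fun _ hs =>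
  MeasurableSpace.measurableSet_iInf.2 fun i => (measurable_const (a := w i)) hs

theorem setLIntegral_hyperplaneLaw_fst (d : ℕ) (pH : PMF ℕ) (w : ℕ → ℝ≥0∞)
    {S : Set (Σ h : ℕ, Matrix (Fin (d + 1)) (Fin h) ℝ)} (hS : MeasurableSet S) :
    ∫⁻ W in S, w W.1 ∂hyperplaneLaw d pH =
      ∑' h, pH h * (w h * gaussianMatrix d h {W | ⟨h, W⟩ ∈ S}) := by
  rw [hyperplaneLaw, Measure.restrict_sum _ hS, lintegral_sum_measure]
  refine tsum_congr fun h => ?_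
  rw [Measure.restrict_smul, lintegral_smul_measure, setLIntegral_map hS
    (measurable_comp_sigma_fst w) (measurable_sigma_mk d h)]
  exact congrArg (pH h * ·) (setLIntegral_const _ (w h))

end GaussianMatrix

section HyperplaneArrangement

open InnerProductGeometry

variable {d : ℕ}

theorem measurable_hyperplaneArrangement_α (q : ℝ) (hq : q < 0) (pH : PMF ℕ) :
    Measurable (hyperplaneArrangement d q hq pH).α :=
  measurable_comp_sigma_fst fun h => Real.pi ^ q * (pH h).toReal⁻¹ * ((-1) ^ h * binom q h)

theorem sameCell_hyperplaneArrangement (q : ℝ) (hq : q < 0) (pH : PMF ℕ) (x z : Sphere d) :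
    (hyperplaneArrangement d q hq pH).sameCell x z =
      {W | ∀ j, WithLp.toLp 2 (fun i => W.2 i j) ∈ {g : EuclideanSpace ℝ (Fin (d + 1)) |
        sgn (⟪x.1, g⟫ : EReal) = sgn (⟪z.1, g⟫ : EReal)}} := by
  ext W
  have hinner : ∀ (y : Sphere d) (j : Fin W.1),
      (W.2ᵀ *ᵥ y.1.ofLp) j = ⟪y.1, WithLp.toLp 2 (fun i => W.2 i j)⟫ := by
    intro y j
    simp [Matrix.mulVec, dotProduct, PiLp.inner_apply]
  change (fun j : Fin W.1 => sgn ((W.2ᵀ *ᵥ x.1.ofLp) j : ℝ)) =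
    (fun j : Fin W.1 => sgn ((W.2ᵀ *ᵥ z.1.ofLp) j : ℝ)) ↔ _
  simp only [funext_iff, hinner, Set.mem_ofPred_eq]

theorem measurableSet_sameCell_hyperplaneArrangement (q : ℝ) (hq : q < 0) (pH : PMF ℕ)
    (x z : Sphere d) : MeasurableSet ((hyperplaneArrangement d q hq pH).sameCell x z) := by
  rw [sameCell_hyperplaneArrangement]
  refine MeasurableSpace.measurableSet_iInf.2 fun h => ?_
  change MeasurableSet {W : Matrix (Fin (d + 1)) (Fin h) ℝ |
    ∀ j, WithLp.toLp 2 (fun i => W i j) ∈ {g : EuclideanSpace ℝ (Fin (d + 1)) |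
      sgn (⟪x.1, g⟫ : EReal) = sgn (⟪z.1, g⟫ : EReal)}}
  rw [Set.ofPred_forall]
  refine MeasurableSet.iInter fun j => ?_
  have hcol : Measurable fun W : Matrix (Fin (d + 1)) (Fin h) ℝ =>
      (WithLp.toLp 2 (fun i => W i j) : EuclideanSpace ℝ (Fin (d + 1))) := by
    have : Measurable fun W : Matrix (Fin (d + 1)) (Fin h) ℝ => fun i => W i j :=
      measurable_pi_lambda _ fun i => (measurable_pi_apply j).comp (measurable_pi_apply i)
    fun_prop
  exact hcol (measurableSet_sgn_coe_eq (by fun_prop) (by fun_prop))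

theorem gaussianMatrix_sameCell (hd : 0 < d) (q : ℝ) (hq : q < 0) (pH : PMF ℕ) (x z : Sphere d)
    (h : ℕ) :
    gaussianMatrix d h {W | ⟨h, W⟩ ∈ (hyperplaneArrangement d q hq pH).sameCell x z} =
      ENNReal.ofReal (1 - angle x.1 z.1 / Real.pi) ^ h := by
  rw [← stdGaussian_sgn_inner_eq (by simpa using hd) (norm_eq_of_mem_sphere x)
    (norm_eq_of_mem_sphere z), ← gaussianMatrix_forall_col d h
      (measurableSet_sgn_coe_eq (by fun_prop) (by fun_prop)), sameCell_hyperplaneArrangement]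
  rfl

theorem kernel_hyperplaneArrangement (hd : 0 < d) (q : ℝ) (hq : q < 0) (pH : PMF ℕ)
    (hpH : ∀ h, 0 < pH h) (x z : Sphere d) :
    (hyperplaneArrangement d q hq pH).kernel x z =
      ENNReal.ofReal (Real.pi ^ q) * ∑' h, ENNReal.ofReal ((-1) ^ h * binom q h) *
        ENNReal.ofReal (1 - angle x.1 z.1 / Real.pi) ^ h := by
  have hS := measurableSet_sameCell_hyperplaneArrangement q hq pH x z
  rw [WeightedRandomPartition.kernel_eq_setLIntegral hS, ← ENNReal.tsum_mul_left]
  refine (setLIntegral_hyperplaneLaw_fst d pH (fun h => ENNReal.ofReal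
    (Real.pi ^ q * (pH h).toReal⁻¹ * ((-1) ^ h * binom q h))) hS).trans (tsum_congr fun h => ?_)
  refine (congrArg (fun t => pH h * (_ * t)) (gaussianMatrix_sameCell hd q hq pH x z h)).trans ?_
  rw [ENNReal.ofReal_mul (by positivity), ENNReal.ofReal_mul (by positivity),
    ENNReal.ofReal_inv_of_pos (ENNReal.toReal_pos (hpH h).ne' (pH.apply_ne_top h)),
    ENNReal.ofReal_toReal (pH.apply_ne_top h)]
  calc _ = pH h * (pH h)⁻¹ * (ENNReal.ofReal (Real.pi ^ q) * (ENNReal.ofReal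
        ((-1) ^ h * binom q h) * ENNReal.ofReal (1 - angle x.1 z.1 / Real.pi) ^ h)) := by ring
    _ = _ := by rw [ENNReal.mul_inv_cancel (hpH h).ne' (pH.apply_ne_top h), one_mul]

end HyperplaneArrangement

section BinomialSeries

theorem neg_one_pow_mul_binom_neg (n h : ℕ) :
    (-1) ^ h * binom (-((n + 1 : ℕ) : ℝ)) h = ((h + n).choose n : ℝ) := by
  have hprod : (-1) ^ h * ∏ j ∈ Finset.range h, (-((n + 1 : ℕ) : ℝ) - j) =
      ((n + 1).ascFactorial h : ℝ) := by
    have hsigns : (-1 : ℝ) ^ h = ∏ _j ∈ Finset.range h, (-1 : ℝ) := by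
      rw [Finset.prod_const, Finset.card_range]
    rw [Nat.ascFactorial_eq_prod_range, Nat.cast_prod, hsigns, ← Finset.prod_mul_distrib]
    refine Finset.prod_congr rfl fun j _ => ?_
    push_cast
    ring
  rw [binom, ← mul_div_assoc, hprod, Nat.ascFactorial_eq_factorial_mul_choose, Nat.cast_mul,
    mul_div_cancel_left₀ _ (by positivity), add_comm n h, Nat.choose_symm_add]

theorem tsum_choose_mul_pow (n : ℕ) {t : ℝ} (ht0 : 0 ≤ t) (ht : t ≤ 1) :
    ∑' h : ℕ, ENNReal.ofReal ((h + n).choose n : ℝ) * ENNReal.ofReal t ^ h =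
      (ENNReal.ofReal (1 - t) ^ (n + 1))⁻¹ := by
  rcases ht.lt_or_eq with ht1 | rfl
  · have hs := hasSum_choose_mul_geometric_of_norm_lt_one n (r := t)
      (by rwa [Real.norm_of_nonneg ht0])
    rw [← ENNReal.ofReal_pow (by linarith), ← ENNReal.ofReal_inv_of_pos (pow_pos (by linarith) _),
      ← one_div, ← hs.tsum_eq, ENNReal.ofReal_tsum_of_nonneg (fun h => by positivity) hs.summable]
    refine tsum_congr fun h => ?_
    rw [ENNReal.ofReal_mul (by positivity), ENNReal.ofReal_pow ht0]
  · rw [sub_self, ENNReal.ofReal_zero, zero_pow n.succ_ne_zero, ENNReal.inv_zero]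
    refine top_unique ?_
    rw [← ENNReal.tsum_const_eq_top_of_ne_zero (α := ℕ) (one_ne_zero (α := ℝ≥0∞))]
    refine ENNReal.tsum_le_tsum fun h => ?_
    rw [ENNReal.ofReal_one, one_pow, mul_one, ENNReal.one_le_ofReal]
    exact_mod_cast Nat.choose_pos (Nat.le_add_left n h)

end BinomialSeries

section HilbertKernel

open InnerProductGeometry

variable {d : ℕ}

/-- The Hilbert kernel `angle(x, z)^(-d)` of the sphere, infinite on the diagonal if `d ≥ 1`. -/
noncomputable def hilbertKernel (d : ℕ) (x z : Sphere d) : ℝ≥0∞ :=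
  (ENNReal.ofReal (angle x.1 z.1) ^ d)⁻¹

theorem measurable_hilbertKernel (d : ℕ) :
    Measurable fun p : Sphere d × Sphere d => hilbertKernel d p.1 p.2 := by
  have hangle : Measurable fun p : Sphere d × Sphere d => angle p.1.1 p.2.1 := by
    unfold InnerProductGeometry.angle
    fun_prop
  exact (hangle.ennreal_ofReal.pow_const d).inv

theorem kernel_hilbertArrangement (hd : 0 < d) (pH : PMF ℕ) (hpH : ∀ h, 0 < pH h) :
    (hilbertArrangement d hd pH).kernel = hilbertKernel d := by
  funext x z
  obtain ⟨n, rfl⟩ : ∃ n, d = n + 1 := ⟨d - 1, by omega⟩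
  have hratio0 : 0 ≤ angle x.1 z.1 / Real.pi := div_nonneg (angle_nonneg _ _) Real.pi_pos.le
  have hratio1 : angle x.1 z.1 / Real.pi ≤ 1 := div_le_one_of_le₀ (angle_le_pi _ _) Real.pi_pos.le
  rw [kernel_hyperplaneArrangement hd _ _ pH hpH]
  simp_rw [neg_one_pow_mul_binom_neg]
  rw [tsum_choose_mul_pow n (by linarith) (by linarith), sub_sub_cancel,
    Real.rpow_neg Real.pi_pos.le, Real.rpow_natCast, ENNReal.ofReal_inv_of_pos (by positivity),
    ENNReal.ofReal_pow Real.pi_pos.le, ← ENNReal.mul_inv (Or.inl (by positivity))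
      (Or.inl (by finiteness)), ← mul_pow, ← ENNReal.ofReal_mul Real.pi_pos.le,
    mul_div_cancel₀ _ Real.pi_ne_zero, hilbertKernel]

theorem dist_eq_two_mul_sin_half_angle (x z : Sphere d) :
    dist x z = 2 * Real.sin (angle x.1 z.1 / 2) := by
  have hx : ‖x.1‖ = 1 := norm_eq_of_mem_sphere x
  have hz : ‖z.1‖ = 1 := norm_eq_of_mem_sphere z
  have hsin : 0 ≤ Real.sin (angle x.1 z.1 / 2) := Real.sin_nonneg_of_nonneg_of_le_pi
    (by linarith [angle_nonneg x.1 z.1]) (by linarith [angle_le_pi x.1 z.1, Real.pi_pos])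
  rw [← pow_left_inj₀ dist_nonneg (by positivity) two_ne_zero, Subtype.dist_eq, dist_eq_norm,
    norm_sub_sq_real, hx, hz, ← cos_angle_mul_norm_mul_norm x.1 z.1, hx, hz, mul_pow,
    Real.sin_sq_eq_half_sub]
  ring_nf

theorem hilbertKernel_eq_top_iff (hd : 0 < d) {x z : Sphere d} :
    hilbertKernel d x z = ⊤ ↔ x = z := by
  rw [hilbertKernel, ENNReal.inv_eq_top, pow_eq_zero_iff hd.ne', ENNReal.ofReal_eq_zero,
    (angle_nonneg _ _).ge_iff_eq']
  constructor
  · intro hangle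
    rw [← dist_eq_zero, dist_eq_two_mul_sin_half_angle, hangle, zero_div, Real.sin_zero, mul_zero]
  · rintro rfl
    exact angle_self (ne_zero_of_mem_unit_sphere x)

end HilbertKernel

section Ensemble

variable {M : Type*} {K : M → M → ℝ≥0∞} {n : ℕ} {D : Fin n → M × ℤˣ} {x : M} {s : ℤˣ}

/-- The total kernel weight at `x` of the training points with label `s`. -/
noncomputable def labelMass (K : M → M → ℝ≥0∞) {n : ℕ} (D : Fin n → M × ℤˣ) (x : M) (s : ℤˣ) :
    ℝ≥0∞ :=
  ∑ i, if (D i).2 = s then K x (D i).1 else 0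

theorem sum_coe_ennreal_sub {ι : Type*} (t : Finset ι) (a b : ι → ℝ≥0∞) :
    ∑ i ∈ t, ((a i : EReal) - b i) = ((∑ i ∈ t, a i : ℝ≥0∞) : EReal) - (∑ i ∈ t, b i : ℝ≥0∞) := by
  classical
  induction t using Finset.induction_on with
  | empty => simp
  | insert i t hi ih =>
    rw [Finset.sum_insert hi, Finset.sum_insert hi, Finset.sum_insert hi, ih,
      EReal.coe_ennreal_add, EReal.coe_ennreal_add, sub_eq_add_neg, sub_eq_add_neg,
      sub_eq_add_neg, EReal.neg_add (Or.inl (EReal.coe_ennreal_ne_bot _))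
        (Or.inr (EReal.coe_ennreal_ne_bot _)), sub_eq_add_neg, add_add_add_comm]

theorem intUnit_mul_coe_ennreal (s : ℤˣ) (k : ℝ≥0∞) :
    (((s : ℤ) : ℝ) : EReal) * k =
      ((if s = 1 then k else 0 : ℝ≥0∞) : EReal) - (if s = -1 then k else 0 : ℝ≥0∞) := by
  rcases Int.units_eq_one_or s with rfl | rfl <;> simp

theorem ensemble_eq_labelMass_sub (K : M → M → ℝ≥0∞) (D : Fin n → M × ℤˣ) (x : M) :
    ensemble K D x = (labelMass K D x 1 : EReal) - labelMass K D x (-1) := by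
  simp only [ensemble, labelMass, intUnit_mul_coe_ennreal, sum_coe_ennreal_sub]

theorem sgn_ensemble_eq_one_iff :
    sgn (ensemble K D x) = 1 ↔
      labelMass K D x (-1) ≠ ⊤ ∧ labelMass K D x (-1) ≤ labelMass K D x 1 := by
  rw [sgn_eq_one_iff, ensemble_eq_labelMass_sub]
  by_cases htop : labelMass K D x (-1) = ⊤
  · simp [htop]
  · have htop' : (labelMass K D x (-1) : EReal) ≠ ⊤ := by simpa using htop
    rw [EReal.sub_nonneg (Or.inr htop') (Or.inr (EReal.coe_ennreal_ne_bot _)),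
      EReal.coe_ennreal_le_coe_ennreal_iff]
    exact (and_iff_right htop).symm

theorem sgn_ensemble_eq_of_labelMass_lt (h : labelMass K D x (-s) < labelMass K D x s) :
    sgn (ensemble K D x) = s := by
  rcases Int.units_eq_one_or s with rfl | rfl
  · exact sgn_ensemble_eq_one_iff.2 ⟨h.ne_top, h.le⟩
  · rw [neg_neg] at h
    exact (Int.units_eq_one_or _).resolve_left fun hone =>
      h.not_ge (sgn_ensemble_eq_one_iff.1 hone).2

theorem sgn_ensemble_interpolates (hK : ∀ x z, K x z = ⊤ ↔ x = z)
    (hD : ∀ i j, (D i).1 = (D j).1 → (D i).2 = (D j).2) (i : Fin n) :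
    sgn (ensemble K D (D i).1) = (D i).2 := by
  refine sgn_ensemble_eq_of_labelMass_lt ?_
  have htop : labelMass K D (D i).1 (D i).2 = ⊤ :=
    ENNReal.sum_eq_top.2 ⟨i, Finset.mem_univ i, by rw [if_pos rfl, hK]⟩
  rw [htop, lt_top_iff_ne_top]
  refine ENNReal.sum_ne_top.2 fun j _ => ?_
  split_ifs with hneg
  · rw [Ne, hK]
    intro hij
    rw [hD i j hij] at hneg
    exact units_ne_neg_self _ hneg
  · exact ENNReal.zero_ne_top

end Ensemble

section SphereVolume

open Metric Topology
open scoped Pointwise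

variable {d : ℕ} {b : OrthonormalBasis (Fin (d + 1)) ℝ (EuclideanSpace ℝ (Fin (d + 1)))}

theorem exists_orthonormalBasis_zero_eq (x : Sphere d) :
    ∃ b : OrthonormalBasis (Fin (d + 1)) ℝ (EuclideanSpace ℝ (Fin (d + 1))), b 0 = x.1 := by
  obtain ⟨b, hb⟩ := Orthonormal.exists_orthonormalBasis_extension_of_card_eq (𝕜 := ℝ)
    (E := EuclideanSpace ℝ (Fin (d + 1))) (ι := Fin (d + 1)) (by simp) (v := fun _ => x.1)
    (s := {0}) ⟨fun i => by simp, fun i j hij => absurd (Subsingleton.elim i j) hij⟩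
  exact ⟨b, hb 0 rfl⟩

theorem norm_inv_norm_smul_sub_le {E : Type*} [NormedAddCommGroup E] [NormedSpace ℝ E] {x y : E}
    (hx : ‖x‖ = 1) (hy : y ≠ 0) {s : ℝ} (hs : 0 ≤ s) :
    ‖‖y‖⁻¹ • y - x‖ ≤ 2 * ‖y - s • x‖ / ‖y‖ := by
  have hsx : ‖s • x‖ = s := by rw [norm_smul, hx, mul_one, Real.norm_of_nonneg hs]
  have hscale : ‖(s - ‖y‖) • x‖ ≤ ‖y - s • x‖ := by
    rw [norm_smul, hx, mul_one, Real.norm_eq_abs, abs_sub_comm]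
    nth_rw 1 [← hsx]
    exact abs_norm_sub_norm_le _ _
  have hdecomp : ‖y‖⁻¹ • y - x = ‖y‖⁻¹ • ((y - s • x) + (s - ‖y‖) • x) := by
    rw [sub_smul, sub_add_sub_cancel, smul_sub, inv_smul_smul₀ (norm_ne_zero_iff.2 hy)]
  rw [hdecomp, norm_smul, norm_inv, norm_norm, inv_mul_eq_div]
  gcongr
  linarith [norm_add_le (y - s • x) ((s - ‖y‖) • x)]

/-- The box of half-width `ρ` around the axis `b 0`, whose coordinate along the axis ranges over
`I`. Such boxes are compared with the cones over spherical caps centred at `b 0`. -/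
def axialBox (b : OrthonormalBasis (Fin (d + 1)) ℝ (EuclideanSpace ℝ (Fin (d + 1)))) (I : Set ℝ)
    (ρ : ℝ) : Set (EuclideanSpace ℝ (Fin (d + 1))) :=
  {y | ⟪b 0, y⟫ ∈ I ∧ ∀ i : Fin d, |⟪b i.succ, y⟫| ≤ ρ}

theorem volume_axialBox {I : Set ℝ} (hI : MeasurableSet I) (ρ : ℝ) :
    volume (axialBox b I ρ) = volume I * ENNReal.ofReal (2 * ρ) ^ d := by
  let J : Fin (d + 1) → Set ℝ := Fin.cons I fun _ => Set.Icc (-ρ) ρ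
  have hJ : ∀ i, MeasurableSet (J i) := Fin.cases hI fun _ => measurableSet_Icc
  have hcoord := (PiLp.volume_preserving_ofLp (Fin (d + 1))).comp b.measurePreserving_repr
  calc volume (axialBox b I ρ)
    _ = volume (WithLp.ofLp ∘ b.repr ⁻¹' Set.pi Set.univ J) := by
      congr 1
      ext y
      simp [axialBox, J, b.repr_apply_apply, Fin.forall_fin_succ, abs_le]
    _ = volume I * ENNReal.ofReal (2 * ρ) ^ d := by
      rw [hcoord.measure_preimage (MeasurableSet.univ_pi hJ).nullMeasurableSet, volume_pi_pi,
        Fin.prod_univ_succ]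
      simp only [J, Fin.cons_zero, Fin.cons_succ, Real.volume_Icc, Finset.prod_const,
        Finset.card_univ, Fintype.card_fin]
      rw [sub_neg_eq_add, two_mul]

theorem norm_sub_inner_smul_le {I : Set ℝ} {ρ : ℝ} {y : EuclideanSpace ℝ (Fin (d + 1))}
    (hy : y ∈ axialBox b I ρ) : ‖y - ⟪b 0, y⟫ • b 0‖ ≤ d * ρ := by
  have hsum : y - ⟪b 0, y⟫ • b 0 = ∑ i : Fin d, ⟪b i.succ, y⟫ • b i.succ := by
    rw [sub_eq_iff_eq_add']
    conv_lhs => rw [← b.sum_repr' y, Fin.sum_univ_succ]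
  rw [hsum]
  calc ‖∑ i : Fin d, ⟪b i.succ, y⟫ • b i.succ‖
    _ ≤ ∑ _i : Fin d, ρ := norm_sum_le_of_le _ fun i _ => by
      rw [norm_smul, b.orthonormal.1, mul_one]
      exact hy.2 i
    _ = d * ρ := by simp

theorem Ioo_smul_closedBall_subset_axialBox {x : Sphere d} (hb : b 0 = x.1) (r : ℝ) :
    Set.Ioo (0 : ℝ) 1 • ((↑) '' closedBall x r) ⊆ axialBox b (Set.Icc (-1) 1) r := by
  rintro _ ⟨t, ⟨ht0, ht1⟩, _, ⟨w, hw, rfl⟩, rfl⟩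
  have hscale : ∀ i, |⟪b i, t • w.1⟫| ≤ |⟪b i, w.1⟫| := fun i => by
    rw [inner_smul_right, abs_mul, abs_of_pos ht0]
    exact mul_le_of_le_one_left (abs_nonneg _) ht1.le
  refine ⟨abs_le.1 ((hscale 0).trans ?_), fun i => (hscale i.succ).trans ?_⟩
  · simpa using abs_real_inner_le_norm (b 0) w.1
  · have horth : ⟪b i.succ, x.1⟫ = 0 := by
      rw [← hb]
      exact b.orthonormal.2 (Fin.succ_ne_zero i)
    calc |⟪b i.succ, w.1⟫|
      _ = |⟪b i.succ, w.1 - x.1⟫| := by rw [inner_sub_right, horth, sub_zero]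
      _ ≤ ‖b i.succ‖ * ‖w.1 - x.1‖ := abs_real_inner_le_norm _ _
      _ = dist w x := by rw [b.orthonormal.1, one_mul, Subtype.dist_eq, dist_eq_norm]
      _ ≤ r := hw

theorem axialBox_subset_Ioo_smul_closedBall {x : Sphere d} (hb : b 0 = x.1) {r ρ : ℝ}
    (hr : r ≤ 2) (hρ : d * ρ ≤ r / 8) :
    axialBox b (Set.Icc (1 / 4) (1 / 2)) ρ ⊆ Set.Ioo (0 : ℝ) 1 • ((↑) '' closedBall x r) := by
  intro y hy
  have hx : ‖x.1‖ = 1 := norm_eq_of_mem_sphere x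
  obtain ⟨hs_ge, hs_le⟩ := hy.1
  have haxis := (norm_sub_inner_smul_le hy).trans hρ
  rw [hb] at hs_ge hs_le haxis
  have hs_norm : ⟪x.1, y⟫ ≤ ‖y‖ := by simpa [hx] using real_inner_le_norm x.1 y
  have hpos : 0 < ‖y‖ := by linarith
  have hlt : ‖y‖ < 1 := by
    have hsx : ‖⟪x.1, y⟫ • x.1‖ = ⟪x.1, y⟫ := by
      rw [norm_smul, hx, mul_one, Real.norm_of_nonneg (by linarith)]
    linarith [norm_sub_norm_le y (⟪x.1, y⟫ • x.1)]
  have hunit : ‖‖y‖⁻¹ • y‖ = 1 := norm_smul_inv_norm (norm_pos_iff.1 hpos)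
  refine ⟨‖y‖, ⟨hpos, hlt⟩, ‖y‖⁻¹ • y, ⟨⟨‖y‖⁻¹ • y, mem_sphere_zero_iff_norm.2 hunit⟩, ?_, rfl⟩,
    smul_inv_smul₀ hpos.ne' y⟩
  rw [mem_closedBall, Subtype.dist_eq, dist_eq_norm]
  refine (norm_inv_norm_smul_sub_le hx (norm_pos_iff.1 hpos) (s := ⟪x.1, y⟫) (by linarith)).trans ?_
  rw [div_le_iff₀ hpos]
  nlinarith [norm_nonneg (y - ⟪x.1, y⟫ • x.1)]

theorem sphereVolume_apply {S : Set (Sphere d)} (hS : MeasurableSet S) :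
    sphereVolume d S = ENNReal.ofReal (d + 1) * volume (Set.Ioo (0 : ℝ) 1 • ((↑) '' S :
      Set (EuclideanSpace ℝ (Fin (d + 1))))) := by
  rw [sphereVolume, Measure.toSphere_apply' _ hS, finrank_euclideanSpace_fin,
    ← ENNReal.ofReal_natCast, Nat.cast_add_one]

theorem sphereVolume_closedBall_le (d : ℕ) : ∃ C : ℝ, 0 < C ∧ ∀ (x : Sphere d) (r : ℝ), 0 ≤ r →
    sphereVolume d (closedBall x r) ≤ ENNReal.ofReal (C * r ^ d) := by
  refine ⟨(d + 1) * (2 * 2 ^ d), by positivity, fun x r hr => ?_⟩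
  obtain ⟨b, hb⟩ := exists_orthonormalBasis_zero_eq x
  calc sphereVolume d (closedBall x r)
    _ ≤ ENNReal.ofReal (d + 1) * volume (axialBox b (Set.Icc (-1) 1) r) := by
      rw [sphereVolume_apply isClosed_closedBall.measurableSet]
      gcongr
      exact Ioo_smul_closedBall_subset_axialBox hb r
    _ = ENNReal.ofReal ((d + 1) * (2 * 2 ^ d) * r ^ d) := by
      rw [volume_axialBox measurableSet_Icc, Real.volume_Icc, ← ENNReal.ofReal_pow (by positivity),
        ← ENNReal.ofReal_mul (by norm_num), ← ENNReal.ofReal_mul (by positivity)]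
      ring_nf

theorem le_sphereVolume_closedBall (d : ℕ) : ∃ c : ℝ, 0 < c ∧ ∀ (x : Sphere d) (r : ℝ), 0 ≤ r →
    r ≤ 2 → ENNReal.ofReal (c * r ^ d) ≤ sphereVolume d (closedBall x r) := by
  refine ⟨(d + 1) * (1 / 4 * (1 / (4 * (d + 1))) ^ d), by positivity, fun x r hr hr2 => ?_⟩
  obtain ⟨b, hb⟩ := exists_orthonormalBasis_zero_eq x
  have hρ : d * (r / (8 * (d + 1))) ≤ r / 8 := by
    rw [mul_div_assoc', div_le_div_iff₀ (by positivity) (by norm_num)]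
    nlinarith
  calc ENNReal.ofReal ((d + 1) * (1 / 4 * (1 / (4 * (d + 1))) ^ d) * r ^ d)
    _ = ENNReal.ofReal (d + 1) *
        volume (axialBox b (Set.Icc (1 / 4) (1 / 2)) (r / (8 * (d + 1)))) := by
      rw [volume_axialBox measurableSet_Icc, Real.volume_Icc, ← ENNReal.ofReal_pow (by positivity),
        ← ENNReal.ofReal_mul (by norm_num), ← ENNReal.ofReal_mul (by positivity), mul_assoc,
        mul_assoc (1 / 4 : ℝ), ← mul_pow]
      congr 4
      · norm_num
      · field_simp
        ring
    _ ≤ sphereVolume d (closedBall x r) := by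
      rw [sphereVolume_apply isClosed_closedBall.measurableSet]
      gcongr
      exact axialBox_subset_Ioo_smul_closedBall hb hr2 hρ

instance isUnifLocDoublingMeasure_sphereVolume (d : ℕ) :
    IsUnifLocDoublingMeasure (sphereVolume d) := by
  obtain ⟨C, hC, hup⟩ := sphereVolume_closedBall_le d
  obtain ⟨c, hc, hlow⟩ := le_sphereVolume_closedBall d
  refine ⟨⟨(C * 2 ^ d / c).toNNReal, ?_⟩⟩
  filter_upwards [Ioo_mem_nhdsGT (two_pos (α := ℝ))] with ε hε x
  calc sphereVolume d (closedBall x (2 * ε))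
    _ ≤ ENNReal.ofReal (C * (2 * ε) ^ d) := hup x (2 * ε) (by linarith [hε.1])
    _ = ENNReal.ofReal (C * 2 ^ d / c) * ENNReal.ofReal (c * ε ^ d) := by
      rw [← ENNReal.ofReal_mul (by positivity), mul_pow]
      congr 1
      field_simp
    _ ≤ (C * 2 ^ d / c).toNNReal * sphereVolume d (closedBall x ε) := by
      rw [ENNReal.ofNNReal_toNNReal]
      gcongr
      exact hlow x ε hε.1.le hε.2.le

instance isFiniteMeasure_sphereVolume (d : ℕ) : IsFiniteMeasure (sphereVolume d) :=
  inferInstanceAs (IsFiniteMeasure (volume : Measure (EuclideanSpace ℝ (Fin (d + 1)))).toSphere)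

theorem nullSingletonClass_sphereVolume (hd : 0 < d) : NullSingletonClass (sphereVolume d) where
  measure_singleton x := by
    obtain ⟨C, -, hup⟩ := sphereVolume_closedBall_le d
    simpa [hd.ne'] using hup x 0 le_rfl

theorem ae_tendsto_closedBall_div {X : Type*} [PseudoMetricSpace X] [MeasurableSpace X]
    [SecondCountableTopology X] [BorelSpace X] (μ ν : Measure X) [IsUnifLocDoublingMeasure μ]
    [IsLocallyFiniteMeasure μ] [IsLocallyFiniteMeasure ν] :
    ∀ᵐ x ∂μ, Tendsto (fun r => ν (closedBall x r) / μ (closedBall x r)) (𝓝[>] 0)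
      (𝓝 (ν.rnDeriv μ x)) := by
  filter_upwards [(IsUnifLocDoublingMeasure.vitaliFamily μ 1).ae_tendsto_rnDeriv ν] with x hx
  refine hx.comp (IsUnifLocDoublingMeasure.tendsto_closedBall_filterAt _ (fun _ => x) id
    tendsto_id ?_)
  filter_upwards [self_mem_nhdsWithin] with r hr
  simpa using le_of_lt hr

end SphereVolume

section TruncatedWeights

open Set

variable {T : Type*} {w : T → ℝ≥0∞} {M : ℝ} {A : Set T}

/-- The weight function `w` truncated at height `M`, as a real-valued function. -/
noncomputable def trunc (w : T → ℝ≥0∞) (M : ℝ) (p : T) : ℝ := (min (w p) (ENNReal.ofReal M)).toReal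

theorem trunc_nonneg (w : T → ℝ≥0∞) (M : ℝ) (p : T) : 0 ≤ trunc w M p := ENNReal.toReal_nonneg

theorem trunc_le (w : T → ℝ≥0∞) (hM : 0 ≤ M) (p : T) : trunc w M p ≤ M :=
  ENNReal.toReal_le_of_le_ofReal hM (min_le_right _ _)

theorem ofReal_trunc (w : T → ℝ≥0∞) (M : ℝ) (p : T) :
    ENNReal.ofReal (trunc w M p) = min (w p) (ENNReal.ofReal M) :=
  ENNReal.ofReal_toReal (ne_top_of_le_ne_top ENNReal.ofReal_ne_top (min_le_right _ _))

theorem le_trunc_iff (w : T → ℝ≥0∞) {t : ℝ} (htM : t ≤ M) (p : T) :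
    t ≤ trunc w M p ↔ ENNReal.ofReal t ≤ w p := by
  rw [← ENNReal.ofReal_le_ofReal_iff (trunc_nonneg w M p), ofReal_trunc, le_min_iff]
  exact and_iff_left (ENNReal.ofReal_le_ofReal htM)

/-- The weight function `w` truncated at height `M`, with sign `+1` on `A` and `-1` on `Aᶜ`. -/
noncomputable def signedTrunc (w : T → ℝ≥0∞) (M : ℝ) (A : Set T) (p : T) : ℝ :=
  A.indicator (trunc w M) p - Aᶜ.indicator (trunc w M) p

theorem signedTrunc_sq (w : T → ℝ≥0∞) (M : ℝ) (A : Set T) (p : T) :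
    signedTrunc w M A p ^ 2 = trunc w M p ^ 2 := by
  by_cases hp : p ∈ A <;> simp [signedTrunc, hp]

theorem abs_signedTrunc_le (w : T → ℝ≥0∞) (hM : 0 ≤ M) (A : Set T) (p : T) :
    |signedTrunc w M A p| ≤ M := by
  refine abs_le_of_sq_le_sq ?_ hM
  rw [signedTrunc_sq]
  exact pow_le_pow_left₀ (trunc_nonneg w M p) (trunc_le w hM p) 2

theorem sum_signedTrunc_nonpos {ι : Type*} {s : Finset ι} {p : ι → T}
    (hp : ∀ i ∈ s, w (p i) ≤ ENNReal.ofReal M)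
    (hle : ∑ i ∈ s, A.indicator w (p i) ≤ ∑ i ∈ s, Aᶜ.indicator w (p i)) :
    ∑ i ∈ s, signedTrunc w M A (p i) ≤ 0 := by
  have hnonneg : ∀ (B : Set T) (i : ι), 0 ≤ B.indicator (trunc w M) (p i) :=
    fun B i => indicator_nonneg (fun q _ => trunc_nonneg w M q) _
  have hsum : ∀ B : Set T, ∑ i ∈ s, B.indicator w (p i) =
      ENNReal.ofReal (∑ i ∈ s, B.indicator (trunc w M) (p i)) := by
    intro B
    rw [ENNReal.ofReal_sum_of_nonneg fun i _ => hnonneg B i]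
    refine Finset.sum_congr rfl fun i hi => ?_
    by_cases hB : p i ∈ B
    · rw [indicator_of_mem hB, indicator_of_mem hB, ofReal_trunc, min_eq_left (hp i hi)]
    · rw [indicator_of_notMem hB, indicator_of_notMem hB, ENNReal.ofReal_zero]
  rw [hsum, hsum, ENNReal.ofReal_le_ofReal_iff (Finset.sum_nonneg fun i _ => hnonneg _ i)] at hle
  simp only [signedTrunc, Finset.sum_sub_distrib]
  exact sub_nonpos.2 hle

variable [MeasurableSpace T]

theorem measurable_trunc (hw : Measurable w) (M : ℝ) : Measurable (trunc w M) :=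
  (hw.min measurable_const).ennreal_toReal

theorem measurable_signedTrunc (hw : Measurable w) (M : ℝ) (hA : MeasurableSet A) :
    Measurable (signedTrunc w M A) :=
  ((measurable_trunc hw M).indicator hA).sub ((measurable_trunc hw M).indicator hA.compl)

theorem integrable_trunc (hw : Measurable w) (hM : 0 ≤ M) (ν : Measure T) [IsFiniteMeasure ν] :
    Integrable (trunc w M) ν :=
  Integrable.of_bound (measurable_trunc hw M).aestronglyMeasurable M <|
    Eventually.of_forall fun p => (Real.norm_of_nonneg (trunc_nonneg w M p)).trans_le
      (trunc_le w hM p)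

theorem integral_signedTrunc (hw : Measurable w) (hM : 0 ≤ M) (hA : MeasurableSet A)
    (ν : Measure T) [IsFiniteMeasure ν] :
    ∫ p, signedTrunc w M A p ∂ν = ∫ p in A, trunc w M p ∂ν - ∫ p in Aᶜ, trunc w M p ∂ν := by
  have hint := integrable_trunc hw hM ν
  simp only [signedTrunc]
  rw [integral_sub (hint.indicator hA) (hint.indicator hA.compl), integral_indicator hA,
    integral_indicator hA.compl]

theorem measure_le_trunc (w : T → ℝ≥0∞) {t : ℝ} (ht : 0 < t) (hM : 0 ≤ M) (ν : Measure T) :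
    ν {p | t ≤ trunc w M p} =
      (Ioc 0 M).indicator (fun t => ν {p | ENNReal.ofReal t ≤ w p}) t := by
  by_cases htM : t ≤ M
  · rw [indicator_of_mem (show t ∈ Ioc 0 M from ⟨ht, htM⟩)]
    simp_rw [le_trunc_iff w htM]
  · rw [indicator_of_notMem fun hmem => htM hmem.2]
    exact measure_mono_null (fun p hp => htM (le_trans hp (trunc_le w hM p))) measure_empty

theorem ofReal_integral_trunc (hw : Measurable w) (hM : 0 ≤ M) (ν : Measure T)
    [IsFiniteMeasure ν] :
    ENNReal.ofReal (∫ p, trunc w M p ∂ν) = ∫⁻ t in Ioc 0 M, ν {p | ENNReal.ofReal t ≤ w p} := by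
  have hnonneg : 0 ≤ᵐ[ν] trunc w M := Eventually.of_forall (trunc_nonneg w M)
  rw [ofReal_integral_eq_lintegral_ofReal (integrable_trunc hw hM ν) hnonneg,
    lintegral_eq_lintegral_meas_le ν hnonneg (measurable_trunc hw M).aemeasurable,
    setLIntegral_congr_fun measurableSet_Ioi (fun t ht => measure_le_trunc w ht hM ν),
    setLIntegral_indicator measurableSet_Ioc, inter_eq_left.2 Ioc_subset_Ioi_self]

theorem setLIntegral_const_div {c t₀ : ℝ} (hc : 0 ≤ c) (ht₀ : 0 < t₀) (hM : t₀ ≤ M) :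
    ∫⁻ t in Ioc t₀ M, ENNReal.ofReal (c / t) = ENNReal.ofReal (c * Real.log (M / t₀)) := by
  have hcont : ContinuousOn (fun t : ℝ => c / t) (Icc t₀ M) :=
    continuousOn_const.div continuousOn_id fun t ht => (ht₀.trans_le ht.1).ne'
  rw [← ofReal_integral_eq_lintegral_ofReal
    (hcont.integrableOn_Icc.mono_set Ioc_subset_Icc_self), ← intervalIntegral.integral_of_le hM]
  · simp_rw [div_eq_mul_inv c]
    rw [intervalIntegral.integral_const_mul, integral_inv_of_pos ht₀ (ht₀.trans_le hM)]
  · filter_upwards [ae_restrict_mem measurableSet_Ioc] with t ht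
    exact div_nonneg hc (ht₀.trans ht.1).le

theorem measurable_tail (w : T → ℝ≥0∞) (ν : Measure T) :
    Measurable fun t : ℝ => ν {p | ENNReal.ofReal t ≤ w p} :=
  Antitone.measurable fun _ _ hst => measure_mono fun _ hp =>
    (ENNReal.ofReal_le_ofReal hst).trans hp

theorem mul_log_sub_le_integral_trunc_sub (hw : Measurable w) {ν₁ ν₂ : Measure T}
    [IsFiniteMeasure ν₁] [IsFiniteMeasure ν₂] {c t₀ : ℝ} (hc : 0 ≤ c) (ht₀ : 0 < t₀) (hM : t₀ ≤ M)
    (htail : ∀ t, t₀ ≤ t → ν₂ {p | ENNReal.ofReal t ≤ w p} + ENNReal.ofReal (c / t) ≤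
      ν₁ {p | ENNReal.ofReal t ≤ w p}) :
    c * Real.log (M / t₀) - ν₂.real univ * t₀ ≤ ∫ p, trunc w M p ∂ν₁ - ∫ p, trunc w M p ∂ν₂ := by
  have hM0 : 0 ≤ M := ht₀.le.trans hM
  have hlog : 0 ≤ c * Real.log (M / t₀) := mul_nonneg hc (Real.log_nonneg ((one_le_div ht₀).2 hM))
  have hint₁ : 0 ≤ ∫ p, trunc w M p ∂ν₁ := integral_nonneg (trunc_nonneg w M)
  have hint₂ : 0 ≤ ∫ p, trunc w M p ∂ν₂ := integral_nonneg (trunc_nonneg w M)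
  have hsmall : ∫⁻ t in Ioc 0 t₀, ν₂ {p | ENNReal.ofReal t ≤ w p} ≤
      ENNReal.ofReal (ν₂.real univ * t₀) := by
    calc ∫⁻ t in Ioc 0 t₀, ν₂ {p | ENNReal.ofReal t ≤ w p}
      _ ≤ ∫⁻ _t in Ioc 0 t₀, ν₂ univ := lintegral_mono fun t => measure_mono (subset_univ _)
      _ = ENNReal.ofReal (ν₂.real univ * t₀) := by
        rw [setLIntegral_const, Real.volume_Ioc, sub_zero, ENNReal.ofReal_mul measureReal_nonneg,
          ofReal_measureReal]
  have hlarge : (∫⁻ t in Ioc t₀ M, ν₂ {p | ENNReal.ofReal t ≤ w p}) +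
      ENNReal.ofReal (c * Real.log (M / t₀)) ≤
      ∫⁻ t in Ioc t₀ M, ν₁ {p | ENNReal.ofReal t ≤ w p} := by
    rw [← setLIntegral_const_div hc ht₀ hM, ← lintegral_add_left (measurable_tail w ν₂)]
    exact setLIntegral_mono (measurable_tail w ν₁) fun t ht => htail t ht.1.le
  suffices hsum : (∫ p, trunc w M p ∂ν₂) + c * Real.log (M / t₀) ≤
      ν₂.real univ * t₀ + ∫ p, trunc w M p ∂ν₁ by linarith
  rw [← ENNReal.ofReal_le_ofReal_iff (by positivity), ENNReal.ofReal_add hint₂ hlog,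
    ENNReal.ofReal_add (by positivity) hint₁, ofReal_integral_trunc hw hM0,
    ofReal_integral_trunc hw hM0]
  calc (∫⁻ t in Ioc 0 M, ν₂ {p | ENNReal.ofReal t ≤ w p}) + ENNReal.ofReal (c * Real.log (M / t₀))
    _ = (∫⁻ t in Ioc 0 t₀, ν₂ {p | ENNReal.ofReal t ≤ w p}) +
        ((∫⁻ t in Ioc t₀ M, ν₂ {p | ENNReal.ofReal t ≤ w p}) +
          ENNReal.ofReal (c * Real.log (M / t₀))) := by
      rw [← Ioc_union_Ioc_eq_Ioc ht₀.le hM,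
        lintegral_union measurableSet_Ioc (Ioc_disjoint_Ioc_of_le le_rfl), add_assoc]
    _ ≤ ENNReal.ofReal (ν₂.real univ * t₀) + ∫⁻ t in Ioc 0 M, ν₁ {p | ENNReal.ofReal t ≤ w p} :=
      add_le_add hsmall (hlarge.trans (lintegral_mono_set (Ioc_subset_Ioc_left ht₀.le)))

theorem integral_trunc_sq_le (hw : Measurable w) {ν : Measure T} {C : ℝ} (hC : 0 ≤ C)
    (hM : 0 ≤ M) (htail : ∀ t, 0 < t → ν {p | ENNReal.ofReal t ≤ w p} ≤ ENNReal.ofReal (C / t)) :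
    ∫ p, trunc w M p ^ 2 ∂ν ≤ 2 * C * M := by
  have hlayer := lintegral_rpow_eq_lintegral_meas_le_mul ν
    (Eventually.of_forall (trunc_nonneg w M)) (measurable_trunc hw M).aemeasurable two_pos
  have hexp : (2 : ℝ) - 1 = 1 := by norm_num
  simp only [Real.rpow_two, hexp, Real.rpow_one] at hlayer
  rw [integral_eq_lintegral_of_nonneg_ae (Eventually.of_forall fun p => sq_nonneg _)
    ((measurable_trunc hw M).pow_const 2).aestronglyMeasurable]
  refine ENNReal.toReal_le_of_le_ofReal (by positivity) ?_
  rw [hlayer, mul_assoc, ENNReal.ofReal_mul two_pos.le]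
  gcongr
  calc ∫⁻ t in Ioi (0 : ℝ), ν {p | t ≤ trunc w M p} * ENNReal.ofReal t
    _ ≤ ∫⁻ t in Ioi (0 : ℝ), (Ioc 0 M).indicator (fun _ => ENNReal.ofReal C) t := by
      refine setLIntegral_mono (measurable_const.indicator measurableSet_Ioc) fun t ht => ?_
      rw [measure_le_trunc w ht hM]
      by_cases hmem : t ∈ Ioc 0 M
      · rw [indicator_of_mem hmem, indicator_of_mem hmem]
        refine (mul_le_mul_left (htail t ht) _).trans ?_
        rw [← ENNReal.ofReal_mul (div_nonneg hC (le_of_lt ht)), div_mul_cancel₀ _ (ne_of_gt ht)]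
      · rw [indicator_of_notMem hmem, indicator_of_notMem hmem, zero_mul]
    _ = ENNReal.ofReal (C * M) := by
      rw [setLIntegral_indicator measurableSet_Ioc, inter_eq_left.2 Ioc_subset_Ioi_self,
        setLIntegral_const, Real.volume_Ioc, sub_zero, ENNReal.ofReal_mul hC]

theorem exists_forall_tail_le (ν : Measure T) [IsFiniteMeasure ν] {C : ℝ}
    (htail : ∀ᶠ t in atTop, ν {p | ENNReal.ofReal t ≤ w p} ≤ ENNReal.ofReal (C / t)) :
    ∃ C', 0 ≤ C' ∧ ∀ t, 0 < t → ν {p | ENNReal.ofReal t ≤ w p} ≤ ENNReal.ofReal (C' / t) := by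
  obtain ⟨t₀, ht₀⟩ := eventually_atTop.1 htail
  refine ⟨max (ν.real univ * |t₀|) C, le_max_of_le_left (by positivity), fun t ht => ?_⟩
  rcases le_total t₀ t with hle | hle
  · refine (ht₀ t hle).trans (ENNReal.ofReal_le_ofReal ?_)
    gcongr
    exact le_max_right _ _
  · refine (measure_mono (subset_univ _)).trans ?_
    rw [← ofReal_measureReal]
    refine ENNReal.ofReal_le_ofReal ((le_div_iff₀ ht).2 (le_max_of_le_left ?_))
    gcongr
    exact hle.trans (le_abs_self t₀)

end TruncatedWeights

section CompetingSums

open Set Topology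

variable {Ω : Type*} [MeasurableSpace Ω] {P : Measure Ω}

theorem measure_sum_nonpos_le {ι : Type*} {s : Finset ι} (hs : s.Nonempty) {X : ι → Ω → ℝ}
    [IsProbabilityMeasure P] (hX : ∀ i ∈ s, MemLp (X i) 2 P)
    (hindep : Set.Pairwise s fun i j => X i ⟂ᵢ[P] X j) {m V : ℝ} (hm : 0 < m)
    (hmean : ∀ i ∈ s, m ≤ ∫ ω, X i ω ∂P) (hsq : ∀ i ∈ s, ∫ ω, X i ω ^ 2 ∂P ≤ V) :
    P {ω | ∑ i ∈ s, X i ω ≤ 0} ≤ ENNReal.ofReal (V / (s.card * m ^ 2)) := by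
  have : (0 : ℝ) < s.card := Nat.cast_pos.2 hs.card_pos
  have hsum_mean : s.card * m ≤ ∫ ω, (∑ i ∈ s, X i) ω ∂P := by
    simp only [Finset.sum_apply]
    rw [integral_finsetSum _ fun i hi => (hX i hi).integrable one_le_two, ← nsmul_eq_mul]
    exact Finset.card_nsmul_le_sum _ _ _ hmean
  have hsum_var : Var[∑ i ∈ s, X i; P] ≤ s.card * V := by
    rw [IndepFun.variance_sum hX hindep, ← nsmul_eq_mul]
    exact Finset.sum_le_card_nsmul _ _ _ fun i hi =>
      (variance_le_expectation_sq (hX i hi).aestronglyMeasurable).trans (hsq i hi)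
  calc P {ω | ∑ i ∈ s, X i ω ≤ 0}
    _ ≤ P {ω | s.card * m ≤ |(∑ i ∈ s, X i) ω - ∫ ω, (∑ i ∈ s, X i) ω ∂P|} := by
      refine measure_mono fun ω (hω : ∑ i ∈ s, X i ω ≤ 0) => ?_
      rw [mem_ofPred_eq, abs_sub_comm, Finset.sum_apply]
      exact le_trans (by linarith) (le_abs_self _)
    _ ≤ ENNReal.ofReal (Var[∑ i ∈ s, X i; P] / (s.card * m) ^ 2) :=
      meas_ge_le_variance_div_sq (memLp_finsetSum' _ hX) (by positivity)
    _ ≤ ENNReal.ofReal (s.card * V / (s.card * m) ^ 2) := by gcongr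
    _ = ENNReal.ofReal (V / (s.card * m ^ 2)) := by
      congr 1
      field_simp

variable {T : Type*} [MeasurableSpace T] {w : T → ℝ≥0∞} {A : Set T} {μ : Measure T}
  {Z : ℕ → Ω → T} [IsProbabilityMeasure P]

theorem measure_sum_signedTrunc_nonpos_le (hw : Measurable w) (hA : MeasurableSet A)
    (hZ : ∀ i, Measurable (Z i)) (hlaw : ∀ i, P.map (Z i) = μ) (hind : iIndepFun Z P)
    {C m M : ℝ} (hC : 0 ≤ C) (hM : 0 ≤ M) (hm : 0 < m)
    (htail : ∀ t, 0 < t → μ {p | ENNReal.ofReal t ≤ w p} ≤ ENNReal.ofReal (C / t))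
    (hmean : m ≤ ∫ p, signedTrunc w M A p ∂μ) {n : ℕ} (hn : 0 < n) :
    P {ω | ∑ i ∈ Finset.range n, signedTrunc w M A (Z i ω) ≤ 0} ≤
      ENNReal.ofReal (2 * C * M / (n * m ^ 2)) := by
  have hmeas := measurable_signedTrunc hw M hA
  nth_rw 2 [← Finset.card_range n]
  refine measure_sum_nonpos_le (X := fun i ω => signedTrunc w M A (Z i ω))
    (Finset.nonempty_range_iff.2 hn.ne') (fun i _ => ?_) (fun i _ j _ hij => ?_) hm (fun i _ => ?_)
    fun i _ => ?_
  · exact MemLp.of_bound (hmeas.comp (hZ i)).aestronglyMeasurable M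
      (Eventually.of_forall fun ω => abs_signedTrunc_le w hM A _)
  · exact (hind.indepFun hij).comp hmeas hmeas
  · rwa [← integral_map (hZ i).aemeasurable hmeas.aestronglyMeasurable, hlaw i]
  · rw [← integral_map (f := fun p => signedTrunc w M A p ^ 2) (hZ i).aemeasurable
      (hmeas.pow_const 2).aestronglyMeasurable, hlaw i]
    simp_rw [signedTrunc_sq]
    exact integral_trunc_sq_le hw hC hM htail

theorem measure_sum_indicator_le (hw : Measurable w) (hA : MeasurableSet A)
    (hZ : ∀ i, Measurable (Z i)) (hlaw : ∀ i, P.map (Z i) = μ) (hind : iIndepFun Z P)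
    {C m M : ℝ} (hC : 0 ≤ C) (hM : 0 < M) (hm : 0 < m)
    (htail : ∀ t, 0 < t → μ {p | ENNReal.ofReal t ≤ w p} ≤ ENNReal.ofReal (C / t))
    (hmean : m ≤ ∫ p, signedTrunc w M A p ∂μ) {n : ℕ} (hn : 0 < n) :
    P {ω | ∑ i ∈ Finset.range n, A.indicator w (Z i ω) ≤
        ∑ i ∈ Finset.range n, Aᶜ.indicator w (Z i ω)} ≤
      ENNReal.ofReal (2 * C * M / (n * m ^ 2) + n * (C / M)) := by
  have hsub : {ω | ∑ i ∈ Finset.range n, A.indicator w (Z i ω) ≤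
        ∑ i ∈ Finset.range n, Aᶜ.indicator w (Z i ω)} ⊆
      {ω | ∑ i ∈ Finset.range n, signedTrunc w M A (Z i ω) ≤ 0} ∪
        ⋃ i ∈ Finset.range n, Z i ⁻¹' {p | ENNReal.ofReal M ≤ w p} := by
    intro ω hω
    refine or_iff_not_imp_right.2 fun hsmall => sum_signedTrunc_nonpos (fun i hi => ?_) hω
    by_contra! hlarge
    exact hsmall (mem_biUnion hi hlarge.le)
  have hlarge : P (⋃ i ∈ Finset.range n, Z i ⁻¹' {p | ENNReal.ofReal M ≤ w p}) ≤
      ENNReal.ofReal (n * (C / M)) := by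
    calc P (⋃ i ∈ Finset.range n, Z i ⁻¹' {p | ENNReal.ofReal M ≤ w p})
      _ ≤ ∑ i ∈ Finset.range n, P (Z i ⁻¹' {p | ENNReal.ofReal M ≤ w p}) :=
        measure_biUnion_finset_le _ _
      _ ≤ ∑ _i ∈ Finset.range n, ENNReal.ofReal (C / M) := by
        refine Finset.sum_le_sum fun i _ => ?_
        rw [← Measure.map_apply (hZ i) (measurableSet_le measurable_const hw), hlaw i]
        exact htail M hM
      _ = ENNReal.ofReal (n * (C / M)) := by
        rw [Finset.sum_const, Finset.card_range, nsmul_eq_mul, ENNReal.ofReal_mul (by positivity),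
          ENNReal.ofReal_natCast]
  rw [ENNReal.ofReal_add (by positivity) (by positivity)]
  exact (measure_mono hsub).trans ((measure_union_le _ _).trans (add_le_add
    (measure_sum_signedTrunc_nonpos_le hw hA hZ hlaw hind hC hM.le hm htail hmean hn) hlarge))

theorem eventually_half_mul_log_le {c t₀ : ℝ} (hc : 0 < c) (ht₀ : 0 < t₀) (b : ℝ) :
    ∀ᶠ n : ℕ in atTop, c / 2 * Real.log n ≤ c * Real.log (n * Real.log n / t₀) - b := by
  have hlog : Tendsto (fun n : ℕ => Real.log n) atTop atTop :=
    Real.tendsto_log_atTop.comp tendsto_natCast_atTop_atTop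
  have hhalf := hlog.const_mul_atTop (half_pos hc)
  filter_upwards [hlog.eventually_ge_atTop 1, hhalf.eventually_ge_atTop (c * Real.log t₀ + b),
    eventually_gt_atTop 0] with n hone hge hn
  have hn' : (0 : ℝ) < n := Nat.cast_pos.2 hn
  have hmono : Real.log n ≤ Real.log (n * Real.log n) :=
    Real.log_le_log hn' (le_mul_of_one_le_right hn'.le hone)
  rw [Real.log_div (by positivity) ht₀.ne']
  nlinarith

theorem tendsto_measure_sum_indicator_le (hw : Measurable w) (hA : MeasurableSet A)
    (hZ : ∀ i, Measurable (Z i)) (hlaw : ∀ i, P.map (Z i) = μ) (hind : iIndepFun Z P)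
    {C c : ℝ} (hc : 0 < c)
    (htail : ∀ᶠ t in atTop, μ {p | ENNReal.ofReal t ≤ w p} ≤ ENNReal.ofReal (C / t))
    (hdrift : ∀ᶠ t in atTop, μ.restrict Aᶜ {p | ENNReal.ofReal t ≤ w p} + ENNReal.ofReal (c / t) ≤
      μ.restrict A {p | ENNReal.ofReal t ≤ w p}) :
    Tendsto (fun n : ℕ => P {ω | ∑ i ∈ Finset.range n, A.indicator w (Z i ω) ≤
        ∑ i ∈ Finset.range n, Aᶜ.indicator w (Z i ω)}) atTop (𝓝 0) := by
  have : IsProbabilityMeasure μ := hlaw 0 ▸ Measure.isProbabilityMeasure_map (hZ 0).aemeasurable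
  obtain ⟨C', hC', htail'⟩ := exists_forall_tail_le μ htail
  obtain ⟨t₀, hdrift', ht₀⟩ := ((eventually_forall_ge_atTop.2 hdrift).and
    (eventually_gt_atTop 0)).exists
  have hlog : Tendsto (fun n : ℕ => Real.log n) atTop atTop :=
    Real.tendsto_log_atTop.comp tendsto_natCast_atTop_atTop
  have hlim : Tendsto (fun n : ℕ => ENNReal.ofReal ((8 * C' / c ^ 2 + C') / Real.log n)) atTop
      (𝓝 0) := by
    rw [← ENNReal.ofReal_zero]
    exact ENNReal.tendsto_ofReal (hlog.const_div_atTop _)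
  refine tendsto_of_tendsto_of_tendsto_of_le_of_le' tendsto_const_nhds hlim
    (Eventually.of_forall fun _ => zero_le) ?_
  filter_upwards [eventually_half_mul_log_le hc ht₀ ((μ.restrict Aᶜ).real univ * t₀),
    hlog.eventually_ge_atTop 1, tendsto_natCast_atTop_atTop.eventually_ge_atTop t₀,
    eventually_gt_atTop 0] with n hhalf hone hge hn
  have hn' : (0 : ℝ) < n := Nat.cast_pos.2 hn
  have : 0 < Real.log n := one_pos.trans_le hone
  -- Height `n log n`: a weight exceeds it with probability only `O(1 / (n log n))`, while the mean
  -- of the truncated difference still grows like `log n`.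
  have hM : t₀ ≤ n * Real.log n := hge.trans (le_mul_of_one_le_right hn'.le hone)
  have hmean : c / 2 * Real.log n ≤ ∫ p, signedTrunc w (n * Real.log n) A p ∂μ := by
    rw [integral_signedTrunc hw (by positivity) hA]
    exact hhalf.trans (mul_log_sub_le_integral_trunc_sub hw hc.le ht₀ hM hdrift')
  refine (measure_sum_indicator_le hw hA hZ hlaw hind hC' (by positivity) (by positivity) htail'
    hmean hn).trans (ENNReal.ofReal_le_ofReal (le_of_eq ?_))
  field_simp
  ring

end CompetingSums

section LabelLaw

theorem compl_setOf_snd_eq {S : Type*} (s : ℤˣ) : {p : S × ℤˣ | p.2 = s}ᶜ = {p | p.2 = -s} :=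
  Set.ext fun _ => Int.units_ne_iff_eq_neg

variable {S : Type*} [MeasurableSpace S]

/-- The law of the points with label `s`, a measure of total mass `Pr {Y = s}`. -/
noncomputable def labelLaw (μ : Measure (S × ℤˣ)) (s : ℤˣ) : Measure S :=
  (μ.restrict {p | p.2 = s}).fst

instance isFiniteMeasure_labelLaw (μ : Measure (S × ℤˣ)) [IsFiniteMeasure μ] (s : ℤˣ) :
    IsFiniteMeasure (labelLaw μ s) := by
  unfold labelLaw
  infer_instance

theorem measurableSet_setOf_snd_eq (s : ℤˣ) : MeasurableSet {p : S × ℤˣ | p.2 = s} :=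
  measurable_snd (measurableSet_singleton s)

theorem labelLaw_add_labelLaw_neg (μ : Measure (S × ℤˣ)) (s : ℤˣ) :
    labelLaw μ s + labelLaw μ (-s) = μ.fst := by
  rw [labelLaw, labelLaw, Measure.fst, Measure.fst, ← Measure.map_add _ _ measurable_fst,
    ← compl_setOf_snd_eq, Measure.restrict_add_restrict_compl (measurableSet_setOf_snd_eq s),
    Measure.fst]

theorem labelMass_eq_sum_indicator {M : Type*} (K : M → M → ℝ≥0∞) (n : ℕ) (D : ℕ → M × ℤˣ) (x : M)
    (s : ℤˣ) : labelMass K (fun j : Fin n => D j) x s =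
      ∑ i ∈ Finset.range n, {p : M × ℤˣ | p.2 = s}.indicator (fun p => K x p.1) (D i) := by
  classical
  simp only [labelMass, Finset.sum_range, Set.indicator_apply, Set.mem_ofPred_eq]

end LabelLaw

section KernelTails

open Set Topology Metric InnerProductGeometry

variable {d : ℕ} {t : ℝ}

/-- The radius, in the chordal metric, of the ball of angular radius `t ^ (-1 / d)`, which is a
superlevel set of the Hilbert kernel. -/
noncomputable def hilbertRadius (d : ℕ) (t : ℝ) : ℝ := 2 * Real.sin (t⁻¹ ^ (d : ℝ)⁻¹ / 2)

theorem inv_rpow_inv_le_one (d : ℕ) (ht : 1 ≤ t) : t⁻¹ ^ (d : ℝ)⁻¹ ≤ 1 :=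
  Real.rpow_le_one (by positivity) (inv_le_one_of_one_le₀ ht) (by positivity)

theorem hilbertRadius_le (d : ℕ) (ht : 0 ≤ t) : hilbertRadius d t ≤ t⁻¹ ^ (d : ℝ)⁻¹ := by
  have hsin := Real.sin_le (x := t⁻¹ ^ (d : ℝ)⁻¹ / 2) (by positivity)
  rw [hilbertRadius]
  linarith

theorem le_hilbertRadius (d : ℕ) (ht : 1 ≤ t) :
    2 / Real.pi * t⁻¹ ^ (d : ℝ)⁻¹ ≤ hilbertRadius d t := by
  have hsin := Real.mul_le_sin (x := t⁻¹ ^ (d : ℝ)⁻¹ / 2) (by positivity)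
    (by linarith [inv_rpow_inv_le_one d ht, Real.pi_gt_three])
  rw [hilbertRadius]
  linarith

theorem hilbertRadius_pos (d : ℕ) (ht : 1 ≤ t) : 0 < hilbertRadius d t :=
  (by positivity : 0 < 2 / Real.pi * t⁻¹ ^ (d : ℝ)⁻¹).trans_le (le_hilbertRadius d ht)

theorem hilbertRadius_pow_le (hd : 0 < d) (ht : 1 ≤ t) : hilbertRadius d t ^ d ≤ t⁻¹ :=
  (pow_le_pow_left₀ (hilbertRadius_pos d ht).le (hilbertRadius_le d (by positivity)) d).trans_eq
    (Real.rpow_inv_natCast_pow (by positivity) hd.ne')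

theorem le_hilbertRadius_pow (hd : 0 < d) (ht : 1 ≤ t) :
    (2 / Real.pi) ^ d * t⁻¹ ≤ hilbertRadius d t ^ d := by
  rw [← Real.rpow_inv_natCast_pow (inv_nonneg.2 (zero_le_one.trans ht)) hd.ne', ← mul_pow]
  exact pow_le_pow_left₀ (by positivity) (le_hilbertRadius d ht) d

theorem tendsto_hilbertRadius (hd : 0 < d) : Tendsto (hilbertRadius d) atTop (𝓝[>] 0) := by
  have hpow : Tendsto (fun t : ℝ => t⁻¹ ^ (d : ℝ)⁻¹) atTop (𝓝 0) := by
    have hcont := Real.continuousAt_rpow_const 0 (d : ℝ)⁻¹ (Or.inr (by positivity))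
    simpa [Function.comp_def, hd.ne'] using hcont.tendsto.comp tendsto_inv_atTop_zero
  refine tendsto_nhdsWithin_iff.2 ⟨?_, ?_⟩
  · refine tendsto_of_tendsto_of_tendsto_of_le_of_le' tendsto_const_nhds hpow ?_ ?_
    · filter_upwards [eventually_ge_atTop 1] with t ht using (hilbertRadius_pos d ht).le
    · filter_upwards [eventually_ge_atTop 0] with t ht using hilbertRadius_le d ht
  · filter_upwards [eventually_ge_atTop 1] with t ht using hilbertRadius_pos d ht

theorem setOf_le_hilbertKernel (hd : 0 < d) (ht : 1 ≤ t) (x : Sphere d) :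
    {y | ENNReal.ofReal t ≤ hilbertKernel d x y} = closedBall x (hilbertRadius d t) := by
  ext y
  have hangle := angle_nonneg x.1 y.1
  have hpow := Real.rpow_inv_natCast_pow (x := t⁻¹) (by positivity) hd.ne'
  have hτ : 0 ≤ t⁻¹ ^ (d : ℝ)⁻¹ := by positivity
  rw [mem_ofPred_eq, hilbertKernel, ENNReal.le_inv_iff_le_inv,
    ← ENNReal.ofReal_inv_of_pos (by positivity), ← ENNReal.ofReal_pow hangle,
    ENNReal.ofReal_le_ofReal_iff (by positivity), ← hpow, pow_le_pow_iff_left₀ hangle hτ hd.ne',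
    mem_closedBall, dist_comm, dist_eq_two_mul_sin_half_angle, hilbertRadius,
    mul_le_mul_iff_right₀ two_pos, Real.strictMonoOn_sin.le_iff_le,
    div_le_div_iff_of_pos_right two_pos]
  · exact ⟨by linarith [Real.pi_pos], by linarith [angle_le_pi x.1 y.1]⟩
  · exact ⟨by linarith [Real.pi_pos],
      by linarith [inv_rpow_inv_le_one d ht, Real.pi_gt_three]⟩

theorem exists_sphereVolume_hilbertRadius_le (hd : 0 < d) : ∃ C : ℝ, 0 < C ∧
    ∀ (x : Sphere d) (t : ℝ), 1 ≤ t →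
      sphereVolume d (closedBall x (hilbertRadius d t)) ≤ ENNReal.ofReal (C / t) := by
  obtain ⟨C, hC, hup⟩ := sphereVolume_closedBall_le d
  refine ⟨C, hC, fun x t ht => (hup x _ (hilbertRadius_pos d ht).le).trans ?_⟩
  rw [div_eq_mul_inv]
  gcongr
  exact hilbertRadius_pow_le hd ht

theorem exists_le_sphereVolume_hilbertRadius (hd : 0 < d) : ∃ c : ℝ, 0 < c ∧
    ∀ (x : Sphere d) (t : ℝ), 1 ≤ t →
      ENNReal.ofReal (c / t) ≤ sphereVolume d (closedBall x (hilbertRadius d t)) := by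
  obtain ⟨c, hc, hlow⟩ := le_sphereVolume_closedBall d
  refine ⟨c * (2 / Real.pi) ^ d, by positivity, fun x t ht => le_trans ?_ <|
    hlow x _ (hilbertRadius_pos d ht).le ?_⟩
  · rw [div_eq_mul_inv, mul_assoc]
    gcongr
    exact le_hilbertRadius_pow hd ht
  · linarith [hilbertRadius_le d (zero_le_one.trans ht), inv_rpow_inv_le_one d ht]

theorem exists_eventually_le_const_div {l : Filter ℝ} {m v : ℝ → ℝ≥0∞} {a : ℝ≥0∞} {C : ℝ}
    (ha : a ≠ ⊤) (hlim : Tendsto (fun t => m t / v t) l (𝓝 a))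
    (hv : ∀ᶠ t in l, v t ≤ ENNReal.ofReal (C / t)) :
    ∃ C', ∀ᶠ t in l, m t ≤ ENNReal.ofReal (C' / t) := by
  obtain ⟨e, hae, -⟩ := ENNReal.lt_iff_exists_nnreal_btwn.1 (lt_top_iff_ne_top.2 ha)
  refine ⟨e * C, ?_⟩
  filter_upwards [hlim.eventually_lt_const hae, hv] with t hratio hvt
  calc m t
    _ ≤ e * v t := (ENNReal.div_le_iff_le_mul (Or.inr ENNReal.coe_ne_top)
      (Or.inr (ne_bot_of_gt hae))).1 hratio.le
    _ ≤ e * ENNReal.ofReal (C / t) := by gcongr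
    _ = ENNReal.ofReal (e * C / t) := by
      rw [mul_div_assoc, ENNReal.ofReal_mul e.coe_nonneg, ENNReal.ofReal_coe_nnreal]

theorem exists_eventually_add_const_div_le {l : Filter ℝ} {m₁ m₂ v : ℝ → ℝ≥0∞} {a b : ℝ≥0∞} {c : ℝ}
    (hab : b < a) (h₁ : Tendsto (fun t => m₁ t / v t) l (𝓝 a))
    (h₂ : Tendsto (fun t => m₂ t / v t) l (𝓝 b)) (hc : 0 < c) (hl : ∀ᶠ t in l, 0 < t)
    (hv : ∀ᶠ t in l, ENNReal.ofReal (c / t) ≤ v t) :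
    ∃ c' > 0, ∀ᶠ t in l, m₂ t + ENNReal.ofReal (c' / t) ≤ m₁ t := by
  obtain ⟨k, hk, hbka⟩ := ENNReal.lt_iff_exists_add_pos_lt.1 hab
  refine ⟨k * c, by positivity, ?_⟩
  filter_upwards [(h₂.add_const _).eventually_lt h₁ hbka, hl, hv] with t hratio ht hvt
  have hv0 : v t ≠ 0 := ((ENNReal.ofReal_pos.2 (div_pos hc ht)).trans_le hvt).ne'
  have hvtop : v t ≠ ⊤ := fun htop => by simp [htop] at hratio
  calc m₂ t + ENNReal.ofReal (k * c / t)
    _ = m₂ t / v t * v t + k * ENNReal.ofReal (c / t) := by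
      rw [ENNReal.div_mul_cancel hv0 hvtop, mul_div_assoc, ENNReal.ofReal_mul k.coe_nonneg,
        ENNReal.ofReal_coe_nnreal]
    _ ≤ (m₂ t / v t + k) * v t := by
      rw [add_mul]
      gcongr
    _ ≤ m₁ t := ENNReal.mul_le_of_le_div hratio.le

variable {x : Sphere d} {ν ν₁ ν₂ : Measure (Sphere d)} {a b : ℝ≥0∞}

theorem exists_hilbertKernel_tail_le (hd : 0 < d) (ha : a ≠ ⊤)
    (hlim : Tendsto (fun r => ν (closedBall x r) / sphereVolume d (closedBall x r))
      (𝓝[>] 0) (𝓝 a)) :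
    ∃ C, ∀ᶠ t in atTop, ν {y | ENNReal.ofReal t ≤ hilbertKernel d x y} ≤
      ENNReal.ofReal (C / t) := by
  obtain ⟨C, -, hvol⟩ := exists_sphereVolume_hilbertRadius_le hd
  obtain ⟨C', hC'⟩ := exists_eventually_le_const_div ha (hlim.comp (tendsto_hilbertRadius hd))
    ((eventually_ge_atTop 1).mono (hvol x))
  refine ⟨C', ?_⟩
  filter_upwards [hC', eventually_ge_atTop 1] with t htail ht
  rwa [setOf_le_hilbertKernel hd ht]

theorem exists_hilbertKernel_tail_add_le (hd : 0 < d) (hab : b < a)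
    (h₁ : Tendsto (fun r => ν₁ (closedBall x r) / sphereVolume d (closedBall x r))
      (𝓝[>] 0) (𝓝 a))
    (h₂ : Tendsto (fun r => ν₂ (closedBall x r) / sphereVolume d (closedBall x r))
      (𝓝[>] 0) (𝓝 b)) :
    ∃ c > 0, ∀ᶠ t in atTop, ν₂ {y | ENNReal.ofReal t ≤ hilbertKernel d x y} +
      ENNReal.ofReal (c / t) ≤ ν₁ {y | ENNReal.ofReal t ≤ hilbertKernel d x y} := by
  obtain ⟨c, hc, hvol⟩ := exists_le_sphereVolume_hilbertRadius hd
  have hradius := tendsto_hilbertRadius hd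
  obtain ⟨c', hc', hdrift⟩ := exists_eventually_add_const_div_le hab (h₁.comp hradius)
    (h₂.comp hradius) hc (eventually_gt_atTop 0) ((eventually_ge_atTop 1).mono (hvol x))
  refine ⟨c', hc', ?_⟩
  filter_upwards [hdrift, eventually_ge_atTop 1] with t hdrift' ht
  rwa [setOf_le_hilbertKernel hd ht]

variable {Ω : Type*} [MeasurableSpace Ω] {P : Measure Ω} [IsProbabilityMeasure P]
  {μ : Measure (Sphere d × ℤˣ)} {Z : ℕ → Ω → Sphere d × ℤˣ}

theorem tendsto_measure_sgn_ensemble_hilbertKernel_ne (hd : 0 < d) (hZ : ∀ i, Measurable (Z i))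
    (hlaw : ∀ i, P.map (Z i) = μ) (hind : iIndepFun Z P) {s : ℤˣ} (ha : a ≠ ⊤) (hab : b < a)
    (hs : Tendsto (fun r => labelLaw μ s (closedBall x r) / sphereVolume d (closedBall x r))
      (𝓝[>] 0) (𝓝 a))
    (hns : Tendsto (fun r => labelLaw μ (-s) (closedBall x r) / sphereVolume d (closedBall x r))
      (𝓝[>] 0) (𝓝 b)) :
    Tendsto (fun n : ℕ => P {ω | sgn (ensemble (hilbertKernel d) (fun j : Fin n => Z j ω) x) ≠ s})
      atTop (𝓝 0) := by
  have hK : Measurable (hilbertKernel d x) := (measurable_hilbertKernel d).of_uncurry_left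
  have hlevel : ∀ t : ℝ, MeasurableSet {y | ENNReal.ofReal t ≤ hilbertKernel d x y} := fun t =>
    measurableSet_le measurable_const hK
  have hfst : Tendsto (fun r => μ.fst (closedBall x r) / sphereVolume d (closedBall x r))
      (𝓝[>] 0) (𝓝 (a + b)) := by
    simpa only [← labelLaw_add_labelLaw_neg μ s, Measure.add_apply, ENNReal.add_div]
      using hs.add hns
  obtain ⟨C, htail⟩ := exists_hilbertKernel_tail_le hd
    (ENNReal.add_ne_top.2 ⟨ha, (hab.trans_le le_top).ne⟩) hfst
  obtain ⟨c, hc, hdrift⟩ := exists_hilbertKernel_tail_add_le hd hab hs hns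
  simp only [labelLaw, Measure.fst_apply (hlevel _)] at htail hdrift
  rw [← compl_setOf_snd_eq] at hdrift
  refine tendsto_of_tendsto_of_tendsto_of_le_of_le tendsto_const_nhds
    (tendsto_measure_sum_indicator_le (hK.comp measurable_fst) (measurableSet_setOf_snd_eq s) hZ
      hlaw hind hc htail hdrift) (fun _ => zero_le) fun n => measure_mono fun ω hω => ?_
  by_contra hlt
  refine hω (sgn_ensemble_eq_of_labelMass_lt ?_)
  rw [labelMass_eq_sum_indicator _ n fun j => Z j ω, labelMass_eq_sum_indicator _ n fun j => Z j ω,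
    ← compl_setOf_snd_eq]
  exact not_le.1 hlt

end KernelTails

section ExcessRisk

open Set

variable {S : Type*} [MeasurableSpace S] {vol : Measure S} {μ : Measure (S × ℤˣ)} {f : S → ℤˣ}

theorem HasDensity.absolutelyContinuous {μX : Measure S} (h : HasDensity vol μX) : μX ≪ vol := by
  obtain ⟨f, -, hf⟩ := h
  refine Measure.AbsolutelyContinuous.mk fun B hB h0 => ?_
  rw [hf B hB, Measure.restrict_eq_zero.2 h0, lintegral_zero_measure]

theorem labelLaw_absolutelyContinuous_fst (μ : Measure (S × ℤˣ)) (s : ℤˣ) : labelLaw μ s ≪ μ.fst :=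
  Measure.restrict_le_self.absolutelyContinuous.map measurable_fst

theorem labelLaw_setOf_mk_mem (μ : Measure (S × ℤˣ)) (s : ℤˣ) {A : Set (S × ℤˣ)}
    (hA : MeasurableSet A) : labelLaw μ s {x | (x, s) ∈ A} = μ (A ∩ {p | p.2 = s}) := by
  have hsec : MeasurableSet {x | (x, s) ∈ A} := measurable_prodMk_right hA
  rw [labelLaw, Measure.fst_apply hsec, Measure.restrict_apply (measurable_fst hsec)]
  congr 1
  ext ⟨x, t⟩
  simp only [mem_inter_iff, mem_preimage, mem_ofPred_eq, and_congr_left_iff]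
  rintro rfl
  rfl

theorem measure_eq_labelLaw_add_labelLaw_neg (μ : Measure (S × ℤˣ)) (s : ℤˣ) {A : Set (S × ℤˣ)}
    (hA : MeasurableSet A) :
    μ A = labelLaw μ s {x | (x, s) ∈ A} + labelLaw μ (-s) {x | (x, -s) ∈ A} := by
  rw [labelLaw_setOf_mk_mem μ s hA, labelLaw_setOf_mk_mem μ (-s) hA, ← compl_setOf_snd_eq,
    ← sdiff_eq, measure_inter_add_sdiff A (measurableSet_setOf_snd_eq s)]

/-- The density with respect to `vol` of the law of the points with label `s`. -/
noncomputable def labelDensity (vol : Measure S) (μ : Measure (S × ℤˣ)) (s : ℤˣ) : S → ℝ≥0∞ :=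
  (labelLaw μ s).rnDeriv vol

theorem measurable_labelDensity (vol : Measure S) (μ : Measure (S × ℤˣ)) (s : ℤˣ) :
    Measurable (labelDensity vol μ s) := Measure.measurable_rnDeriv _ _

theorem measurable_labelDensity_apply (vol : Measure S) (μ : Measure (S × ℤˣ))
    (hf : Measurable f) : Measurable fun x => labelDensity vol μ (f x) x :=
  (measurable_from_prod_countable_left (f := fun p : S × ℤˣ => labelDensity vol μ p.2 p.1)
    (measurable_labelDensity vol μ)).comp (measurable_id.prodMk hf)

open Classical in
/-- The Bayes classifier, which predicts at each point the label of larger density, and the label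
`1` in case of a tie. -/
noncomputable def bayesClassifier (vol : Measure S) (μ : Measure (S × ℤˣ)) (x : S) : ℤˣ :=
  if labelDensity vol μ (-1) x ≤ labelDensity vol μ 1 x then 1 else -1

theorem measurable_bayesClassifier (vol : Measure S) (μ : Measure (S × ℤˣ)) :
    Measurable (bayesClassifier vol μ) :=
  Measurable.ite (measurableSet_le (measurable_labelDensity vol μ _)
    (measurable_labelDensity vol μ _)) measurable_const measurable_const

theorem labelDensity_le_bayesClassifier (s : ℤˣ) (x : S) :
    labelDensity vol μ s x ≤ labelDensity vol μ (bayesClassifier vol μ x) x := by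
  unfold bayesClassifier
  split_ifs with h <;> rcases Int.units_eq_one_or s with rfl | rfl
  · exact le_rfl
  · exact h
  · exact (not_le.1 h).le
  · exact le_rfl

theorem labelDensity_neg_bayesClassifier_le (s : ℤˣ) (x : S) :
    labelDensity vol μ (-bayesClassifier vol μ x) x ≤ labelDensity vol μ s x := by
  by_cases hs : s = bayesClassifier vol μ x
  · rw [hs]
    exact labelDensity_le_bayesClassifier _ x
  · rw [Int.units_ne_iff_eq_neg.1 hs]

/-- The excess of the density of the more likely label over that of the other label, the local price
of not predicting the label of the Bayes classifier. -/
noncomputable def densityGap (vol : Measure S) (μ : Measure (S × ℤˣ)) (x : S) : ℝ≥0∞ :=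
  labelDensity vol μ (bayesClassifier vol μ x) x - labelDensity vol μ (-bayesClassifier vol μ x) x

theorem measurable_densityGap (vol : Measure S) (μ : Measure (S × ℤˣ)) :
    Measurable (densityGap vol μ) :=
  (measurable_labelDensity_apply vol μ (measurable_bayesClassifier vol μ)).sub
    (measurable_labelDensity_apply vol μ (measurable_bayesClassifier vol μ).neg)

theorem labelDensity_le_add_densityGap (s : ℤˣ) (x : S) :
    labelDensity vol μ s x ≤
      labelDensity vol μ (-bayesClassifier vol μ x) x + densityGap vol μ x :=
  (labelDensity_le_bayesClassifier s x).trans le_add_tsub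

theorem lintegral_labelDensity_apply_ne_top [IsFiniteMeasure μ] (f : S → ℤˣ) :
    ∫⁻ x, labelDensity vol μ (f x) x ∂vol ≠ ⊤ := by
  have hsum : ∫⁻ x, labelDensity vol μ 1 x + labelDensity vol μ (-1) x ∂vol ≠ ⊤ := by
    rw [lintegral_add_left (measurable_labelDensity vol μ 1)]
    exact ENNReal.add_ne_top.2
      ⟨(Measure.lintegral_rnDeriv_lt_top _ _).ne, (Measure.lintegral_rnDeriv_lt_top _ _).ne⟩
  refine ne_top_of_le_ne_top hsum (lintegral_mono fun x => ?_)
  rcases Int.units_eq_one_or (f x) with hfx | hfx <;> rw [hfx]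
  exacts [le_self_add, le_add_self]

instance isFiniteMeasure_withDensity_densityGap [IsFiniteMeasure μ] :
    IsFiniteMeasure (vol.withDensity (densityGap vol μ)) :=
  isFiniteMeasure_withDensity <| ne_top_of_le_ne_top (lintegral_labelDensity_apply_ne_top _)
    (lintegral_mono fun _ => tsub_le_self)

variable [SigmaFinite vol] [IsFiniteMeasure μ]

theorem labelLaw_neg_setOf_eq (hac : ∀ s, labelLaw μ s ≪ vol) (hf : Measurable f) (s : ℤˣ) :
    labelLaw μ (-s) {x | f x = s} = ∫⁻ x in {x | f x = s}, labelDensity vol μ (-f x) x ∂vol := by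
  rw [← Measure.setLIntegral_rnDeriv (hac (-s))]
  refine setLIntegral_congr_fun (hf (measurableSet_singleton s)) ?_
  rintro x rfl
  rfl

theorem measure_misclassified (hac : ∀ s, labelLaw μ s ≪ vol) (hf : Measurable f) :
    μ {z | f z.1 ≠ z.2} = ∫⁻ x, labelDensity vol μ (-f x) x ∂vol := by
  have herr : MeasurableSet {z : S × ℤˣ | f z.1 ≠ z.2} :=
    (measurableSet_eq_fun (hf.comp measurable_fst) measurable_snd).compl
  have hone : MeasurableSet {x | f x = 1} := hf (measurableSet_singleton 1)
  have hcompl : {x | f x = 1}ᶜ = {x | f x = -1} := Set.ext fun _ => Int.units_ne_iff_eq_neg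
  rw [measure_eq_labelLaw_add_labelLaw_neg μ (-1) herr, ← lintegral_add_compl _ hone, hcompl,
    ← labelLaw_neg_setOf_eq hac hf, ← labelLaw_neg_setOf_eq hac hf]
  simp only [mem_ofPred_eq, Int.units_ne_iff_eq_neg, neg_neg]

theorem measure_misclassified_le (hac : ∀ s, labelLaw μ s ≪ vol) (hf : Measurable f) :
    μ {z | f z.1 ≠ z.2} ≤ μ {z | bayesClassifier vol μ z.1 ≠ z.2} +
      vol.withDensity (densityGap vol μ) {x | f x ≠ bayesClassifier vol μ x} := by
  have hb := measurable_bayesClassifier vol μ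
  have hne : MeasurableSet {x | f x ≠ bayesClassifier vol μ x} := (measurableSet_eq_fun hf hb).compl
  rw [measure_misclassified hac hf, measure_misclassified hac hb, withDensity_apply _ hne,
    ← lintegral_indicator hne,
    ← lintegral_add_right _ ((measurable_densityGap vol μ).indicator hne)]
  refine lintegral_mono fun x => ?_
  by_cases hx : f x = bayesClassifier vol μ x
  · rw [hx]
    exact le_self_add
  · rw [indicator_of_mem (show x ∈ {x | f x ≠ bayesClassifier vol μ x} from hx)]
    exact labelDensity_le_add_densityGap _ x

theorem risk_bayesClassifier_le (hac : ∀ s, labelLaw μ s ≪ vol) (hf : Measurable f) :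
    risk μ (bayesClassifier vol μ) ≤ risk μ f := by
  refine ENNReal.toReal_mono (measure_ne_top _ _) ?_
  rw [measure_misclassified hac hf, measure_misclassified hac (measurable_bayesClassifier vol μ)]
  exact lintegral_mono fun x => labelDensity_neg_bayesClassifier_le _ x

theorem bayesRisk_eq (hac : ∀ s, labelLaw μ s ≪ vol) :
    bayesRisk μ = risk μ (bayesClassifier vol μ) :=
  let b : {f : S → ℤˣ // Measurable f} := ⟨_, measurable_bayesClassifier vol μ⟩
  have : Nonempty {f : S → ℤˣ // Measurable f} := ⟨b⟩
  le_antisymm (ciInf_le ⟨0, forall_mem_range.2 fun _ => measureReal_nonneg⟩ b)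
    (le_ciInf fun f => risk_bayesClassifier_le hac f.2)

theorem edist_risk_bayesRisk_le (hac : ∀ s, labelLaw μ s ≪ vol) (hf : Measurable f) :
    edist (risk μ f) (bayesRisk μ) ≤
      vol.withDensity (densityGap vol μ) {x | f x ≠ bayesClassifier vol μ x} := by
  have hexcess := ENNReal.toReal_mono (ENNReal.add_ne_top.2 ⟨measure_ne_top _ _,
    measure_ne_top _ _⟩) (measure_misclassified_le hac hf)
  rw [ENNReal.toReal_add (measure_ne_top _ _) (measure_ne_top _ _)] at hexcess
  rw [bayesRisk_eq hac, edist_dist, Real.dist_eq,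
    abs_of_nonneg (sub_nonneg.2 (risk_bayesClassifier_le hac hf))]
  exact ENNReal.ofReal_le_of_le_toReal (sub_le_iff_le_add'.2 hexcess)

end ExcessRisk

section RandomClassifiers

open Set Topology

variable {Ω S ι : Type*} [MeasurableSpace Ω] [MeasurableSpace S] {P : Measure Ω} {l : Filter ι}

theorem tendstoInMeasure_of_edist_le {E : Type*} [PseudoEMetricSpace E] {f : ι → Ω → E} {g : Ω → E}
    {e : ι → Ω → ℝ≥0∞} (he : ∀ i, AEMeasurable (e i) P)
    (hle : ∀ i ω, edist (f i ω) (g ω) ≤ e i ω)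
    (hlim : Tendsto (fun i => ∫⁻ ω, e i ω ∂P) l (𝓝 0)) : TendstoInMeasure P f l g := by
  refine tendstoInMeasure_of_ne_top fun ε hε hεtop => ?_
  have hdiv : Tendsto (fun i => (∫⁻ ω, e i ω ∂P) / ε) l (𝓝 0) := by
    simpa only [ENNReal.zero_div] using ENNReal.Tendsto.div_const hlim (Or.inr hε.ne')
  exact tendsto_of_tendsto_of_tendsto_of_le_of_le tendsto_const_nhds hdiv (fun _ => zero_le)
    fun i => (measure_mono fun ω hω => le_trans hω (hle i ω)).trans
      (meas_ge_le_lintegral_div (he i) hε.ne' hεtop)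

theorem tendsto_lintegral_measure_section [IsFiniteMeasure P] [l.IsCountablyGenerated]
    {ν : Measure S} [IsFiniteMeasure ν] {B : ι → Set (Ω × S)} (hB : ∀ i, MeasurableSet (B i))
    (h : ∀ᵐ x ∂ν, Tendsto (fun i => P {ω | (ω, x) ∈ B i}) l (𝓝 0)) :
    Tendsto (fun i => ∫⁻ ω, ν {x | (ω, x) ∈ B i} ∂P) l (𝓝 0) := by
  have hswap : ∀ i, ∫⁻ ω, ν {x | (ω, x) ∈ B i} ∂P = ∫⁻ x, P {ω | (ω, x) ∈ B i} ∂ν := fun i =>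
    (Measure.prod_apply (hB i)).symm.trans (Measure.prod_apply_symm (hB i))
  simp only [hswap]
  rw [← lintegral_zero (μ := ν)]
  refine tendsto_lintegral_filter_of_dominated_convergence (fun _ => P univ)
    (.of_forall fun i => measurable_measure_prodMk_right (hB i))
    (.of_forall fun i => .of_forall fun x => measure_mono (subset_univ _)) ?_ h
  rw [lintegral_const]
  exact ENNReal.mul_ne_top (measure_ne_top _ _) (measure_ne_top _ _)

theorem tendstoInMeasure_risk [IsFiniteMeasure P] [l.IsCountablyGenerated] {vol : Measure S}
    [SigmaFinite vol] {μ : Measure (S × ℤˣ)} [IsFiniteMeasure μ]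
    (hac : ∀ s, labelLaw μ s ≪ vol) {f : ι → Ω → S → ℤˣ}
    (hf : ∀ i, Measurable fun q : Ω × S => f i q.1 q.2)
    (h : ∀ᵐ x ∂vol, ∀ s, labelDensity vol μ (-s) x < labelDensity vol μ s x →
      Tendsto (fun i => P {ω | f i ω x ≠ s}) l (𝓝 0)) :
    TendstoInMeasure P (fun i ω => risk μ (f i ω)) l (fun _ => bayesRisk μ) := by
  have hdisagree : ∀ i, MeasurableSet {q : Ω × S | f i q.1 q.2 ≠ bayesClassifier vol μ q.2} :=
    fun i => (measurableSet_eq_fun (hf i)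
      ((measurable_bayesClassifier vol μ).comp measurable_snd)).compl
  have hbayes : ∀ᵐ x ∂vol.withDensity (densityGap vol μ),
      Tendsto (fun i => P {ω | f i ω x ≠ bayesClassifier vol μ x}) l (𝓝 0) := by
    rw [ae_withDensity_iff (measurable_densityGap vol μ)]
    filter_upwards [h] with x hx hgap
    exact hx _ (tsub_pos_iff_lt.1 (pos_iff_ne_zero.2 hgap))
  exact tendstoInMeasure_of_edist_le
    (fun i => (measurable_measure_prodMk_left (hdisagree i)).aemeasurable)
    (fun i ω => edist_risk_bayesRisk_le hac ((hf i).comp measurable_prodMk_left))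
    (tendsto_lintegral_measure_section hdisagree hbayes)

end RandomClassifiers

section Consistency

open Set Topology

theorem measurable_ensemble {Ω M : Type*} [MeasurableSpace Ω] [MeasurableSpace M]
    {K : M → M → ℝ≥0∞} (hK : Measurable fun p : M × M => K p.1 p.2) {n : ℕ}
    {Z : Fin n → Ω → M × ℤˣ} (hZ : ∀ i, Measurable (Z i)) :
    Measurable fun q : Ω × M => ensemble K (fun j => Z j q.1) q.2 :=
  Finset.measurable_sum _ fun i _ =>
    ((Measurable.of_discrete (f := fun s : ℤˣ => (((s : ℤ) : ℝ) : EReal))).comp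
      ((hZ i).snd.comp measurable_fst)).mul
    (hK.comp (measurable_snd.prodMk ((hZ i).fst.comp measurable_fst))).coe_ereal_ennreal

theorem ae_ne_of_indepFun {Ω M : Type*} [MeasurableSpace Ω] [MeasurableSpace M] [MeasurableEq M]
    {P : Measure Ω} [IsFiniteMeasure P] {X Y : Ω → M} (hX : AEMeasurable X P)
    (hY : AEMeasurable Y P) [NullSingletonClass (P.map Y)] (hXY : IndepFun X Y P) :
    ∀ᵐ ω ∂P, X ω ≠ Y ω := by
  have hdiag : ∀ᵐ p ∂P.map (fun ω => (X ω, Y ω)), p.1 ≠ p.2 := by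
    rw [hXY.map_prod_eq_prod_map_map hX hY]
    refine (Measure.ae_prod_iff_ae_ae (measurableSet_eq_fun measurable_fst measurable_snd).compl).2
      (.of_forall fun x => ?_)
    filter_upwards [compl_mem_ae_iff.2 (measure_singleton (μ := P.map Y) x)] with y hy
    exact Ne.symm hy
  exact ae_of_ae_map (hX.prodMk hY) hdiag

theorem interpolatingConsistent_hilbertKernel.{v} {d : ℕ} (hd : 0 < d) :
    InterpolatingConsistent.{v} (sphereVolume d)
      (fun _ D x => sgn (ensemble (hilbertKernel d) D x)) := by
  intro Ω _ P _ μ _ Z hZ hlaw hind hdens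
  have hac := hdens.absolutelyContinuous
  have haclabel : ∀ s, labelLaw μ s ≪ sphereVolume d := fun s =>
    (labelLaw_absolutelyContinuous_fst μ s).trans hac
  constructor
  · have hnull := nullSingletonClass_sphereVolume hd
    have hfst : ∀ i, P.map (fun ω => (Z i ω).1) = μ.fst := fun i => by
      rw [← hlaw i, Measure.fst, Measure.map_map measurable_fst (hZ i), Function.comp_def]
    have hdistinct : ∀ᵐ ω ∂P, ∀ i j, i ≠ j → (Z i ω).1 ≠ (Z j ω).1 := by
      simp only [ae_all_iff]
      intro i j hij
      have : NullSingletonClass (P.map fun ω => (Z j ω).1) :=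
        ⟨fun x => hfst j ▸ hac (measure_singleton x)⟩
      exact ae_ne_of_indepFun (hZ i).fst.aemeasurable (hZ j).fst.aemeasurable
        ((hind.indepFun hij).comp measurable_fst measurable_fst)
    filter_upwards [hdistinct] with ω hω n i
    refine sgn_ensemble_interpolates (fun _ _ => hilbertKernel_eq_top_iff hd)
      (D := fun j : Fin n => Z j ω) (fun j k hjk => ?_) i
    rw [not_imp_not.1 (hω j k) hjk]
  · refine tendstoInMeasure_risk haclabel
      (fun n => measurable_sgn.comp
        (measurable_ensemble (measurable_hilbertKernel d) fun i => hZ i)) ?_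
    have hdiff := ae_all_iff.2 fun s => ae_tendsto_closedBall_div (sphereVolume d) (labelLaw μ s)
    have hfin := ae_all_iff.2 fun s => Measure.rnDeriv_lt_top (labelLaw μ s) (sphereVolume d)
    filter_upwards [hdiff, hfin] with x hx hxfin s hs
    exact tendsto_measure_sgn_ensemble_hilbertKernel_ne hd hZ hlaw hind (hxfin s).ne hs (hx s)
      (hx (-s))

end Consistency

end InterpolatingEnsemble

theorem mainTheorem3 (d : ℕ) (hd : 0 < d) (pH : PMF ℕ) (hpH : ∀ h, 0 < pH h) :
    -- away from the training points, the ensemble is the weighted average of the histograms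
    (∀ (n : ℕ) (D : Fin n → Sphere d × ℤˣ) (x : Sphere d), (∀ i, (D i).1 ≠ x) →
      Integrable (fun θ => (hilbertArrangement d hd pH).α θ *
        histogram D ((hilbertArrangement d hd pH).part θ) x) (hilbertArrangement d hd pH).law ∧
      ensemble (hilbertArrangement d hd pH).kernel D x =
        ((∫ θ, (hilbertArrangement d hd pH).α θ *
          histogram D ((hilbertArrangement d hd pH).part θ) x
            ∂(hilbertArrangement d hd pH).law : ℝ) : EReal)) ∧
    -- its sign interpolates every training set in which equal points carry equal labels
    (∀ (n : ℕ) (D : Fin n → Sphere d × ℤˣ), (∀ i j, (D i).1 = (D j).1 → (D i).2 = (D j).2) →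
      ∀ i, sgn (ensemble (hilbertArrangement d hd pH).kernel D (D i).1) = (D i).2) ∧
    -- its sign has the interpolating-consistent property
    InterpolatingConsistent.{u} (sphereVolume d)
      (fun _ D x => sgn (ensemble (hilbertArrangement d hd pH).kernel D x)) := by
  have hkernel := kernel_hilbertArrangement hd pH hpH
  have htop : ∀ x z, (hilbertArrangement d hd pH).kernel x z = ⊤ ↔ x = z := fun x z => by
    rw [hkernel, hilbertKernel_eq_top_iff hd]
  refine ⟨fun n D x hx => ?_, fun n D hD => sgn_ensemble_interpolates htop hD, ?_⟩
  · exact ensemble_kernel_eq_integral_histogram _ (measurable_hyperplaneArrangement_α _ _ pH)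
      (measurableSet_sameCell_hyperplaneArrangement _ _ pH)
      fun i => mt (htop x _).1 (hx i).symm
  · rw [hkernel]
    exact interpolatingConsistent_hilbertKernel hd
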